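/- For $\nu>0$ let $K(\nu)=\Gamma((\nu+1)/2)/\{\sqrt{\pi\nu}\,\Gamma(\nu/2)\}$. Let $0<\alpha<1$ and $\nu_1,\nu_2>0$, put $\alpha^*=\alpha K(\nu_1)/\{\alpha K(\nu_1)+(1-\alpha)K(\nu_2)\}$, and let $X$ be a real random variable with the asymmetric Student's $t$-distribution, that is, with probability density function $$f(x)=\begin{cases}\dfrac{\alpha}{\alpha^*}K(\nu_1)\Big[1+\dfrac{1}{\nu_1}\Big(\dfrac{x}{2\alpha^*}\Big)^2\Big]^{-(\nu_1+1)/2}, & x\le 0,\\[10pt] \dfrac{1-\alpha}{1-\alpha^*}K(\nu_2)\Big[1+\dfrac{1}{\nu_2}\Big(\dfrac{x}{2(1-\alpha^*)}\Big)^2\Big]^{-(\nu_2+1)/2}, & x>0.\end{cases}$$ Then the characteristic function $\phi_X(t)=\mathbb{E}[\mathrm{e}^{\mathrm{i}tX}]$ is given, for all $t\in\mathbb{R}$, by $$\phi_X(t)=\mathcal{A}_{\alpha,\nu_1}(t)+\mathcal{A}_{1-\alpha,\nu_2}(t)+\mathrm{i}\{\mathcal{B}_{1-\alpha,\nu_2}(t)-\mathcal{B}_{\alpha,\nu_1}(t)\}.$$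 Here, for $(\beta,\nu)=(\alpha,\nu_1)$ with $\beta^*=\alpha^*$ and for $(\beta,\nu)=(1-\alpha,\nu_2)$ with $\beta^*=1-\alpha^*$, and with $x=2\beta^*\sqrt{\nu}\,|t|$, for $t\neq0$: $$\mathcal{A}_{\beta,\nu}(t)=\frac{2\beta(\beta^*\sqrt{\nu}|t|)^{\nu/2}K_{\nu/2}(x)}{\Gamma(\nu/2)};$$ if $\nu\notin\{1,3,5,\ldots\}$, $$\mathcal{B}_{\beta,\nu}(t)=\frac{\pi\beta(\beta^*\sqrt{\nu}|t|)^{\nu/2}\,\mathrm{sgn}(t)}{\cos(\pi\nu/2)\Gamma(\nu/2)}\big\{I_{\nu/2}(x)-\mathbf{L}_{-\nu/2}(x)\big\};$$ and if $\nu\in\{1,3,5,\ldots\}$, $$\mathcal{B}_{\beta,\nu}(t)=\frac{2\beta}{\sqrt{\pi}}\frac{\Gamma((\nu+1)/2)}{\Gamma(\nu/2)}\,\mathrm{sgn}(t)\sum_{k=1}^{(\nu+1)/2}\binom{\nu-k}{(\nu-1)/2}\frac{2^{k-\nu-1}}{(k-1)!}\bigg\{x^{k-1}\big[\mathrm{e}^{-x}\mathrm{Ei}(x)+(-1)^k\mathrm{e}^{x}\mathrm{Ei}(-x)\big]-\sum_{j=1}^{k-1}(j-1)!\big[1+(-1)^{k+j}\big]x^{k-j-1}\bigg\}.$$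 At $t=0$ the terms take the values $\mathcal{A}_{\beta,\nu}(0)=\beta$ and $\mathcal{B}_{\beta,\nu}(0)=0$, and with these values all four terms are continuous at $t=0$. In these formulas $I_\mu$ and $K_\mu$ are the modified Bessel functions of the first and second kind, $\mathbf{L}_\mu$ is the modified Struve function of the first kind, $\mathrm{Ei}(x)$ (for real $x\ne0$) is the exponential integral, i.e. the Cauchy principal value of $\int_{-\infty}^x \mathrm{e}^{s}/s\,\mathrm{d}s$, $\mathrm{sgn}$ is the sign function with $\mathrm{sgn}(0)=0$, and empty sums are zero. -/

import Mathlib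

noncomputable section

namespace AST

/-- Modified Bessel function of the first kind `I_μ(x)`, for `x > 0` and real order `μ`.
(`Real.Gamma` is `0` at its poles, so that the terms with `1 / Γ(-n)` vanish, as they should.) -/
def besselI (μ x : ℝ) : ℝ :=
  ∑' k : ℕ, (x / 2) ^ (2 * (k : ℝ) + μ) / ((k.factorial : ℝ) * Real.Gamma ((k : ℝ) + μ + 1))

/-- Modified Struve function of the first kind `L_μ(x)`, for `x > 0` and real order `μ`. -/
def struveL (μ x : ℝ) : ℝ :=
  ∑' k : ℕ, (x / 2) ^ (2 * (k : ℝ) + μ + 1) /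
    (Real.Gamma ((k : ℝ) + 3 / 2) * Real.Gamma ((k : ℝ) + μ + 3 / 2))

/-- Modified Bessel function of the second kind `K_μ(x)`, for `x > 0` and real order `μ`. -/
def besselK (μ x : ℝ) : ℝ :=
  ∫ u in Set.Ioi (0 : ℝ), Real.exp (-x * Real.cosh u) * Real.cosh (μ * u)

/-- Exponential integral `Ei(x)`, for real `x ≠ 0`: the Cauchy principal value of
`∫_{-∞}^x e^s / s ds`. For `x < 0` it is the ordinary integral, `-∫_{-x}^∞ e^{-s} / s ds`. -/
def expInt (x : ℝ) : ℝ :=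
  Filter.limUnder (nhdsWithin (0 : ℝ) (Set.Ioi 0))
    (fun ε : ℝ => ∫ s in Set.Iic x \ Set.Ioo (-ε) ε, Real.exp s / s)

/-- The normalising constant `K(ν)` of Student's t-distribution. -/
def tConst (ν : ℝ) : ℝ :=
  Real.Gamma ((ν + 1) / 2) / (Real.sqrt (Real.pi * ν) * Real.Gamma (ν / 2))

/-- `α^*`, as a function of `α`, `ν₁`, `ν₂`. -/
def alphaStar (α ν₁ ν₂ : ℝ) : ℝ :=
  α * tConst ν₁ / (α * tConst ν₁ + (1 - α) * tConst ν₂)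

/-- Probability density function of the asymmetric Student's t-distribution. -/
def pdfAST (α ν₁ ν₂ x : ℝ) : ℝ :=
  if x ≤ 0 then
    α / alphaStar α ν₁ ν₂ * tConst ν₁ *
      (1 + 1 / ν₁ * (x / (2 * alphaStar α ν₁ ν₂)) ^ 2) ^ (-(ν₁ + 1) / 2)
  else
    (1 - α) / (1 - alphaStar α ν₁ ν₂) * tConst ν₂ *
      (1 + 1 / ν₂ * (x / (2 * (1 - alphaStar α ν₁ ν₂))) ^ 2) ^ (-(ν₂ + 1) / 2)

/-- The term `A_{α,ν}(t)`, where `a` stands for `α^*`. At `t = 0`, where `K_{ν/2}` has a pole,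
it is the value `α` that makes the function continuous. -/
def termA (α a ν t : ℝ) : ℝ :=
  if t = 0 then α
  else
    2 * α * (a * Real.sqrt ν * |t|) ^ (ν / 2) * besselK (ν / 2) (2 * a * Real.sqrt ν * |t|) /
      Real.Gamma (ν / 2)

/-- The term `B_{α,ν}(t)` for `ν` not an odd integer, where `a` stands for `α^*`. -/
def termBGeneral (α a ν t : ℝ) : ℝ :=
  Real.pi * α * (a * Real.sqrt ν * |t|) ^ (ν / 2) * Real.sign t /
      (Real.cos (Real.pi * ν / 2) * Real.Gamma (ν / 2)) *
    (besselI (ν / 2) (2 * a * Real.sqrt ν * |t|) - struveL (-(ν / 2)) (2 * a * Real.sqrt ν * |t|))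

/-- The inner factor of the odd case: with `ν = 2 m + 1`, so that `(ν + 1) / 2 = m + 1`,
`ν - k = 2 m + 1 - k` and `(ν - 1) / 2 = m`, the sum over `k` at the point `x`. -/
def oddSum (m : ℕ) (x : ℝ) : ℝ :=
  ∑ k ∈ Finset.Icc 1 (m + 1),
    (Nat.choose (2 * m + 1 - k) m : ℝ) *
      ((2 : ℝ) ^ ((k : ℤ) - 2 * (m : ℤ) - 2) / ((k - 1).factorial : ℝ)) *
      (x ^ (k - 1) *
          (Real.exp (-x) * expInt x + (-1 : ℝ) ^ k * Real.exp x * expInt (-x)) -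
        ∑ j ∈ Finset.Icc 1 (k - 1),
          ((j - 1).factorial : ℝ) * (1 + (-1 : ℝ) ^ (k + j)) * x ^ (k - j - 1))

/-- The term `B_{α,ν}(t)` for the odd integer `ν = 2 m + 1`, where `a` stands for `α^*`. -/
def termBOdd (α a : ℝ) (m : ℕ) (t : ℝ) : ℝ :=
  2 * α / Real.sqrt Real.pi *
    (Real.Gamma (((2 * (m : ℝ) + 1) + 1) / 2) / Real.Gamma ((2 * (m : ℝ) + 1) / 2)) *
    Real.sign t * oddSum m (2 * a * Real.sqrt (2 * (m : ℝ) + 1) * |t|)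

open Classical in
/-- The term `B_{α,ν}(t)`, where `a` stands for `α^*`. -/
def termB (α a ν t : ℝ) : ℝ :=
  if h : ∃ m : ℕ, ν = 2 * (m : ℝ) + 1 then termBOdd α a h.choose t
  else termBGeneral α a ν t

end AST

end

noncomputable section

open Real Set MeasureTheory Filter Topology

namespace AST

/-! The substitution y = 2a√ν·u turns each half of the density into a constant times (1 + u²)^(-s)
with s = (ν+1)/2. Reflecting the left half replaces t by -t, so the theorem reduces to identifying
the cosine and sine transforms of (1 + u²)^(-s) over the half-line: A is the (even) cosine
transform, B the (odd) sine transform, each up to `termConst`. Continuity then follows because these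
are transforms of an integrable function.

Writing Γ(s)(1 + u²)^(-s) as a Gamma integral makes both transforms mixtures of Gaussian ones
(`gamma_mul_integral_eq`). The Gaussian cosine transform gives `gammaBessel` of order ν/2, that is
K_{ν/2}. The Gaussian sine transform is Dawson's integral, which leaves an average over v in [0,1]
of `gammaBessel` of order μ = (ν-1)/2 (`gamma_mul_sinTransform`).

If ν is not an odd integer, μ is not an integer and `gammaBessel` is a combination of two power
series (`gammaBessel_eq_series`), as in K_μ = (π/2)(I_{-μ} - I_μ)/sin(πμ). Averaging them term by
term produces the Struve and the Bessel I series.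

If ν = 2m+1, the order is an integer and that formula degenerates. Instead, the sine transform and
the finite sum `oddSum` satisfy the same recurrence S_{s+1}' = (1 - xS_s)/(2s) and both vanish at
the origin. The case s = 1 rests on S'' = S - 1/x, where boundedness selects the combination of
exponential integrals (`sinTransform_natCast_add_one`). -/

/-- The half-line sine transform of `(1 + u²)^(-s)`. -/
def sinTransform (s x : ℝ) : ℝ := ∫ u in Ioi (0 : ℝ), sin (x * u) * (1 + u ^ 2) ^ (-s)

/-- The half-line cosine transform of `(1 + u²)^(-s)`. -/
def cosTransform (s x : ℝ) : ℝ := ∫ u in Ioi (0 : ℝ), cos (x * u) * (1 + u ^ 2) ^ (-s)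

/-- The integral `∫₀^∞ t^(μ-1) exp(-t - y/t) dt`, equal to `2 y^(μ/2) K_μ(2√y)` for `y > 0`. -/
def gammaBessel (μ y : ℝ) : ℝ := ∫ t in Ioi (0 : ℝ), t ^ (μ - 1) * exp (-t - y / t)

/-! ### Transforms of (1 + u²)^(-s) through Gaussian subordination. -/

lemma continuous_one_add_sq_rpow (s : ℝ) : Continuous fun u : ℝ => (1 + u ^ 2) ^ (-s) :=
  Continuous.rpow_const (by fun_prop) fun u => Or.inl (by positivity)

lemma integrable_one_add_sq_rpow {s : ℝ} (hs : 1 / 2 < s) :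
    Integrable fun u : ℝ => (1 + u ^ 2) ^ (-s) := by
  have h := integrable_rpow_neg_one_add_norm_sq (E := ℝ) (μ := volume) (r := 2 * s)
    (by simp; linarith)
  refine h.congr (ae_of_all _ fun u => ?_)
  simp only [norm_eq_abs, sq_abs]
  congr 1
  ring

lemma integrableOn_mul_one_add_sq_rpow {s : ℝ} (hs : 1 / 2 < s) {φ : ℝ → ℝ} (hφ : Continuous φ)
    (hb : ∀ u, |φ u| ≤ 1) :
    IntegrableOn (fun u : ℝ => φ u * (1 + u ^ 2) ^ (-s)) (Ioi 0) :=
  (integrable_one_add_sq_rpow hs).integrableOn.bdd_mul hφ.aestronglyMeasurable (c := 1)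
    (ae_of_all _ hb)

lemma integral_gamma_kernel {s : ℝ} (hs : 0 < s) (u : ℝ) :
    ∫ t in Ioi (0 : ℝ), t ^ (s - 1) * exp (-((1 + u ^ 2) * t)) =
      Gamma s * (1 + u ^ 2) ^ (-s) := by
  rw [Real.integral_rpow_mul_exp_neg_mul_Ioi hs (by positivity), one_div,
    Real.inv_rpow (by positivity), Real.rpow_neg (by positivity), mul_comm]

lemma integrableOn_gamma_kernel {s : ℝ} (hs : 0 < s) (u : ℝ) :
    IntegrableOn (fun t : ℝ => t ^ (s - 1) * exp (-((1 + u ^ 2) * t))) (Ioi 0) := by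
  refine (integrable_of_integral_eq_one ?_ : IntegrableOn
    (fun t : ℝ => (Gamma s * (1 + u ^ 2) ^ (-s))⁻¹ * (t ^ (s - 1) * exp (-((1 + u ^ 2) * t))))
      (Ioi 0)).const_mul (Gamma s * (1 + u ^ 2) ^ (-s)) |>.congr (ae_of_all _ fun t => ?_)
  · rw [integral_const_mul, integral_gamma_kernel hs, inv_mul_cancel₀]
    have := Gamma_pos_of_pos hs
    positivity
  · have := Gamma_pos_of_pos hs
    simp only
    field_simp

/-- Subordination: transforms of `(1 + u²)^(-s)` are mixtures of Gaussian transforms. -/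
lemma gamma_mul_integral_eq {s : ℝ} (hs : 1 / 2 < s) {φ : ℝ → ℝ} (hφ : Continuous φ)
    (hb : ∀ u, |φ u| ≤ 1) :
    Gamma s * ∫ u in Ioi (0 : ℝ), φ u * (1 + u ^ 2) ^ (-s) =
      ∫ t in Ioi (0 : ℝ), t ^ (s - 1) * exp (-t) *
        ∫ u in Ioi (0 : ℝ), φ u * exp (-t * u ^ 2) := by
  have hs0 : 0 < s := by linarith
  have hprod : Integrable (Function.uncurry fun u t : ℝ =>
      φ u * (t ^ (s - 1) * exp (-((1 + u ^ 2) * t))))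
      ((volume.restrict (Ioi 0)).prod (volume.restrict (Ioi 0))) := by
    rw [integrable_prod_iff (Measurable.aestronglyMeasurable
      (by have := hφ.measurable; unfold Function.uncurry; fun_prop))]
    refine ⟨ae_of_all _ fun u => (integrableOn_gamma_kernel hs0 u).const_mul (φ u), ?_⟩
    have : ∀ u : ℝ, ∫ t in Ioi (0 : ℝ), ‖φ u * (t ^ (s - 1) * exp (-((1 + u ^ 2) * t)))‖ =
        Gamma s * (|φ u| * (1 + u ^ 2) ^ (-s)) := by
      intro u
      rw [mul_left_comm, ← integral_gamma_kernel hs0, ← integral_const_mul]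
      refine setIntegral_congr_fun measurableSet_Ioi fun t ht => ?_
      have ht : 0 < t := ht
      simp only [norm_mul, norm_eq_abs, abs_exp]
      rw [abs_of_nonneg (rpow_nonneg ht.le _)]
    simp only [Function.uncurry_apply_pair, this]
    exact (integrableOn_mul_one_add_sq_rpow hs hφ.abs (by simpa using hb)).const_mul _
  rw [← integral_const_mul]
  calc _ = ∫ u in Ioi (0 : ℝ), ∫ t in Ioi (0 : ℝ),
        φ u * (t ^ (s - 1) * exp (-((1 + u ^ 2) * t))) := by
        refine integral_congr_ae (ae_of_all _ fun u => ?_)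
        simp only [integral_const_mul, integral_gamma_kernel hs0]
        ring
    _ = _ := by
        rw [integral_integral_swap hprod]
        refine integral_congr_ae (ae_of_all _ fun t => ?_)
        simp only [← integral_const_mul]
        refine integral_congr_ae (ae_of_all _ fun u => ?_)
        have : exp (-((1 + u ^ 2) * t)) = exp (-t) * exp (-t * u ^ 2) := by
          rw [← exp_add]; ring_nf
        simp only [this]
        ring

lemma integral_cos_gaussian {t : ℝ} (ht : 0 < t) (x : ℝ) :
    ∫ u in Ioi (0 : ℝ), cos (x * u) * exp (-t * u ^ 2) =
      √π / 2 * (t ^ (-(1 / 2) : ℝ) * exp (-(x ^ 2 / 4 / t))) := by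
  have h := fourierIntegral_gaussian (b := t) (by simpa using ht) (x : ℂ)
  have h1 : ∫ u : ℝ, cos (x * u) * exp (-t * u ^ 2) =
      √π * (t ^ (-(1 / 2) : ℝ) * exp (-(x ^ 2 / 4 / t))) := by
    have hint : Integrable fun u : ℝ => Complex.exp (Complex.I * x * u) *
        Complex.exp (-(t : ℂ) * (u : ℂ) ^ 2) := by
      refine (integrable_exp_neg_mul_sq ht).mono' (by fun_prop) (ae_of_all _ fun u => ?_)
      rw [norm_mul, Complex.norm_exp, Complex.norm_exp]
      simp [← Complex.ofReal_pow]
    have h2 := congrArg Complex.re h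
    rw [show ((∫ u : ℝ, Complex.exp (Complex.I * x * u) *
        Complex.exp (-(t : ℂ) * (u : ℂ) ^ 2)).re) = RCLike.re (∫ u : ℝ, Complex.exp (Complex.I * x * u) *
        Complex.exp (-(t : ℂ) * (u : ℂ) ^ 2)) from rfl, ← integral_re hint] at h2
    have h3 : ((π : ℂ) / t) ^ (1 / 2 : ℂ) * Complex.exp (-(x : ℂ) ^ 2 / (4 * t)) =
        ((√π * (t ^ (-(1 / 2) : ℝ) * exp (-(x ^ 2 / 4 / t))) : ℝ) : ℂ) := by
      rw [← mul_assoc, sqrt_eq_rpow, rpow_neg ht.le, ← div_eq_mul_inv,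
        ← div_rpow pi_pos.le ht.le, Complex.ofReal_mul, Complex.ofReal_cpow (by positivity)]
      push_cast
      congr 2
      field_simp
    rw [h3, Complex.ofReal_re] at h2
    rw [← h2]
    refine integral_congr_ae (ae_of_all _ fun u => ?_)
    have e1 : Complex.exp (Complex.I * x * u) * Complex.exp (-(t : ℂ) * (u : ℂ) ^ 2) =
      Complex.exp (((x * u : ℝ) : ℂ) * Complex.I) * ((exp (-t * u ^ 2) : ℝ) : ℂ) := by
      push_cast; ring_nf
    simp only [e1, RCLike.re_eq_complex_re, Complex.re_mul_ofReal, Complex.exp_ofReal_mul_I_re]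
  -- The integrand is even, so the half-line integral is half of the full one.
  have h2 : ∫ u : ℝ, cos (x * u) * exp (-t * u ^ 2) =
      ∫ u : ℝ, (fun u => cos (x * u) * exp (-t * u ^ 2)) |u| := by
    refine integral_congr_ae (ae_of_all _ fun u => ?_)
    simp only [sq_abs]
    rcases abs_choice u with h | h <;> simp [h]
  rw [integral_comp_abs (f := fun u => cos (x * u) * exp (-t * u ^ 2)), h1] at h2
  linarith

lemma gamma_mul_cosTransform {s : ℝ} (hs : 1 / 2 < s) (x : ℝ) :
    Gamma s * cosTransform s x = √π / 2 * gammaBessel (s - 1 / 2) (x ^ 2 / 4) := by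
  rw [cosTransform, gamma_mul_integral_eq hs (by fun_prop) fun u => abs_cos_le_one _,
    gammaBessel, ← integral_const_mul]
  refine setIntegral_congr_fun measurableSet_Ioi fun t ht => ?_
  have ht : 0 < t := ht
  simp only [integral_cos_gaussian ht]
  rw [show s - 1 / 2 - 1 = (s - 1) + (-(1 / 2)) by ring, rpow_add ht, sub_eq_add_neg (-t), exp_add]
  ring

lemma gammaBessel_zero {μ : ℝ} (hμ : 0 < μ) : gammaBessel μ 0 = Gamma μ := by
  rw [gammaBessel, Gamma_eq_integral hμ]
  refine integral_congr_ae (ae_of_all _ fun t => ?_)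
  simp [mul_comm]

/-- Differentiation under the integral gives the cosine moment ∫ u cos(xu) e^(-tu²); integrating it
by parts returns the sine transform, hence a first-order linear equation in x. -/
lemma hasDerivAt_integral_sin_gaussian {t : ℝ} (ht : 0 < t) (x : ℝ) :
    HasDerivAt (fun x => ∫ u in Ioi (0 : ℝ), sin (x * u) * exp (-t * u ^ 2))
      (1 / (2 * t) - x / (2 * t) * ∫ u in Ioi (0 : ℝ), sin (x * u) * exp (-t * u ^ 2)) x := by
  have hg := (integrable_exp_neg_mul_sq ht).integrableOn (s := Ioi 0)
  have hg1 := (integrable_mul_exp_neg_mul_sq ht).integrableOn (s := Ioi 0)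
  have hs : IntegrableOn (fun u => sin (x * u) * exp (-t * u ^ 2)) (Ioi 0) :=
    hg.bdd_mul (by fun_prop) (c := 1) (ae_of_all _ fun u => abs_sin_le_one _)
  have hc : IntegrableOn (fun u => cos (x * u) * (u * exp (-t * u ^ 2))) (Ioi 0) :=
    hg1.bdd_mul (by fun_prop) (c := 1) (ae_of_all _ fun u => abs_cos_le_one _)
  have hd := (hasDerivAt_integral_of_dominated_loc_of_deriv_le
    (F := fun x u => sin (x * u) * exp (-t * u ^ 2))
    (F' := fun x u => cos (x * u) * (u * exp (-t * u ^ 2)))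
    (bound := fun u => u * exp (-t * u ^ 2)) (μ := volume.restrict (Ioi 0)) (x₀ := x)
    univ_mem (Eventually.of_forall fun y => by fun_prop) hs (by fun_prop)
    ((ae_restrict_mem measurableSet_Ioi).mono fun u hu y _ => ?_) hg1
    (ae_of_all _ fun u y _ => ?_)).2
  · refine hd.congr_deriv ?_
    have hu : ∀ u : ℝ, HasDerivAt (fun u => -(1 / (2 * t)) * (cos (x * u) * exp (-t * u ^ 2)))
        (cos (x * u) * (u * exp (-t * u ^ 2)) +
          x / (2 * t) * (sin (x * u) * exp (-t * u ^ 2))) u := by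
      intro u
      have h1 : HasDerivAt (fun u : ℝ => x * u) x u := by simpa using (hasDerivAt_id u).const_mul x
      have h2 : HasDerivAt (fun u : ℝ => -t * u ^ 2) (-t * (2 * u)) u := by
        simpa using (hasDerivAt_pow 2 u).const_mul (-t)
      refine ((h1.cos.mul h2.exp).const_mul (-(1 / (2 * t)))).congr_deriv ?_
      field_simp
      ring
    have hlim : Tendsto (fun u => -(1 / (2 * t)) * (cos (x * u) * exp (-t * u ^ 2))) atTop
        (𝓝 0) := by
      have h0 : Tendsto (fun u : ℝ => exp (-t * u ^ 2)) atTop (𝓝 0) :=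
        tendsto_exp_atBot.comp (((tendsto_pow_atTop two_ne_zero).const_mul_atTop_of_neg
          (by linarith : -t < 0)))
      rw [← mul_zero (-(1 / (2 * t)))]
      refine Tendsto.const_mul _ (squeeze_zero_norm (fun u => ?_) h0)
      rw [norm_mul, norm_eq_abs, norm_eq_abs, abs_exp]
      exact mul_le_of_le_one_left (exp_pos _).le (abs_cos_le_one _)
    have h := integral_Ioi_of_hasDerivAt_of_tendsto' (fun u _ => hu u)
      (hc.add (hs.const_mul _)) hlim
    rw [integral_add hc (hs.const_mul _), integral_const_mul] at h
    simp only [mul_zero, cos_zero, ne_eq, OfNat.ofNat_ne_zero, not_false_eq_true, zero_pow,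
      exp_zero, mul_one, zero_sub, neg_neg] at h
    linarith
  · have hu : 0 < u := hu
    rw [norm_mul, norm_eq_abs, norm_eq_abs, abs_of_pos (by positivity : 0 < u * exp (-t * u ^ 2))]
    exact mul_le_of_le_one_left (by positivity) (abs_cos_le_one _)
  · have h1 : HasDerivAt (fun y : ℝ => y * u) u y := by simpa using (hasDerivAt_id y).mul_const u
    exact (h1.sin.mul_const (exp (-t * u ^ 2))).congr_deriv (by ring)

/-- Dawson's integral. -/
lemma integral_sin_gaussian {t : ℝ} (ht : 0 < t) (x : ℝ) :
    ∫ u in Ioi (0 : ℝ), sin (x * u) * exp (-t * u ^ 2) =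
      x / (2 * t) * ∫ v in (0 : ℝ)..1, exp (-(x ^ 2 * (1 - v ^ 2) / 4 / t)) := by
  set Y : ℝ → ℝ := fun x => ∫ u in Ioi (0 : ℝ), sin (x * u) * exp (-t * u ^ 2) with hY
  -- exp(r²/(4t)) is the integrating factor of the linear equation for Y.
  have hz : ∀ r : ℝ, HasDerivAt (fun r => exp (r ^ 2 / (4 * t)) * Y r)
      (1 / (2 * t) * exp (r ^ 2 / (4 * t))) r := by
    intro r
    have h1 : HasDerivAt (fun r : ℝ => r ^ 2 / (4 * t)) (2 * r / (4 * t)) r := by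
      simpa using (hasDerivAt_pow 2 r).div_const (4 * t)
    refine (h1.exp.mul (hasDerivAt_integral_sin_gaussian ht r)).congr_deriv ?_
    change _ * Y r + _ * (_ - _ * Y r) = _
    field_simp
    ring
  have h0 : Y 0 = 0 := by simp [hY]
  have h := intervalIntegral.integral_eq_sub_of_hasDerivAt (a := 0) (b := x) (fun r _ => hz r)
    (Continuous.intervalIntegrable (by fun_prop) _ _)
  rw [h0, mul_zero, sub_zero, intervalIntegral.integral_const_mul] at h
  have hc := intervalIntegral.mul_integral_comp_mul_left (f := fun r => exp (r ^ 2 / (4 * t)))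
    (a := 0) (b := 1) x
  rw [mul_zero, mul_one] at hc
  rw [← hc] at h
  have hY' : Y x = exp (-(x ^ 2 / (4 * t))) * (exp (x ^ 2 / (4 * t)) * Y x) := by
    rw [← mul_assoc, ← exp_add]; simp
  change Y x = _
  rw [hY', ← h]
  have : ∫ v in (0 : ℝ)..1, exp (-(x ^ 2 * (1 - v ^ 2) / 4 / t)) =
      exp (-(x ^ 2 / (4 * t))) * ∫ v in (0 : ℝ)..1, exp ((x * v) ^ 2 / (4 * t)) := by
    rw [← intervalIntegral.integral_const_mul]
    refine intervalIntegral.integral_congr fun v _ => ?_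
    rw [← exp_add]
    congr 1
    field_simp
    ring
  rw [this]
  ring

/-- Subordination followed by Dawson's formula; the factor x/(2t) lowers the power of t by one, and
the t and v integrals are exchanged. -/
lemma gamma_mul_sinTransform {s x : ℝ} (hs : 1 / 2 < s) (hx : 0 < x) :
    Gamma s * sinTransform s x =
      x / 2 * ∫ v in (0 : ℝ)..1, gammaBessel (s - 1) (x ^ 2 * (1 - v ^ 2) / 4) := by
  have hmeas : AEStronglyMeasurable (Function.uncurry fun t v : ℝ =>
      t ^ (s - 1 - 1) * exp (-t - x ^ 2 * (1 - v ^ 2) / 4 / t))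
      ((volume.restrict (Ioi 0)).prod (volume.restrict (Ioc 0 1))) :=
    Measurable.aestronglyMeasurable (by unfold Function.uncurry; fun_prop)
  have hinner : ∀ t : ℝ, 0 < t → ∫ v in (0 : ℝ)..1,
      t ^ (s - 1 - 1) * exp (-t - x ^ 2 * (1 - v ^ 2) / 4 / t) =
      2 / x * (t ^ (s - 1) * exp (-t) * ∫ u in Ioi (0 : ℝ), sin (x * u) * exp (-t * u ^ 2)) := by
    intro t ht
    rw [integral_sin_gaussian ht, intervalIntegral.integral_const_mul, rpow_sub_one ht.ne']
    have : ∀ v : ℝ, exp (-t - x ^ 2 * (1 - v ^ 2) / 4 / t) =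
      exp (-t) * exp (-(x ^ 2 * (1 - v ^ 2) / 4 / t)) := fun v => by
        rw [← exp_add, sub_eq_add_neg]
    simp only [this, intervalIntegral.integral_const_mul]
    field_simp
  have hgauss : ∀ t : ℝ, 0 < t →
      |∫ u in Ioi (0 : ℝ), sin (x * u) * exp (-t * u ^ 2)| ≤ √π / 2 * t ^ (-(1 / 2) : ℝ) := by
    intro t ht
    have h1 := integral_cos_gaussian ht 0
    simp only [zero_mul, cos_zero, one_mul, ne_eq, OfNat.ofNat_ne_zero, not_false_eq_true,
      zero_pow, zero_div, neg_zero, exp_zero, mul_one] at h1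
    rw [← h1, ← norm_eq_abs]
    refine norm_integral_le_of_norm_le ((integrable_exp_neg_mul_sq ht).integrableOn)
      (ae_of_all _ fun u => ?_)
    rw [norm_mul, norm_eq_abs, norm_eq_abs, abs_exp]
    exact mul_le_of_le_one_left (exp_pos _).le (abs_sin_le_one _)
  have hprod : Integrable (Function.uncurry fun t v : ℝ =>
      t ^ (s - 1 - 1) * exp (-t - x ^ 2 * (1 - v ^ 2) / 4 / t))
      ((volume.restrict (Ioi 0)).prod (volume.restrict (Ioc 0 1))) := by
    rw [integrable_prod_iff hmeas]
    constructor
    · refine ae_of_all _ fun t => ?_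
      have : Continuous fun v : ℝ => t ^ (s - 1 - 1) * exp (-t - x ^ 2 * (1 - v ^ 2) / 4 / t) := by
        fun_prop
      exact (this.integrableOn_Icc (a := 0) (b := 1)).mono_set Ioc_subset_Icc_self
    -- The integrand is nonnegative for t > 0, so its v-integral is also the integral of its norm.
    -- By `hinner` this is a Gaussian sine transform, and `hgauss` replaces the lost power t^(-1) by
    -- t^(-1/2), which is integrable even when s < 1.
    · have hdom : IntegrableOn (fun t : ℝ => √π / x * (exp (-t) * t ^ ((s - 1 / 2) - 1))) (Ioi 0) :=
        (GammaIntegral_convergent (by linarith)).const_mul _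
      refine hdom.mono' hmeas.norm.integral_prod_right' ?_
      filter_upwards [ae_restrict_mem measurableSet_Ioi] with t ht
      have ht : 0 < t := ht
      have e1 : ∫ v in Ioc (0 : ℝ) 1, ‖(Function.uncurry fun t v : ℝ =>
          t ^ (s - 1 - 1) * exp (-t - x ^ 2 * (1 - v ^ 2) / 4 / t)) (t, v)‖ =
          2 / x * (t ^ (s - 1) * exp (-t) *
            ∫ u in Ioi (0 : ℝ), sin (x * u) * exp (-t * u ^ 2)) := by
        rw [← hinner t ht, intervalIntegral.integral_of_le zero_le_one]
        refine integral_congr_ae (ae_of_all _ fun v => ?_)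
        simp only [Function.uncurry_apply_pair, norm_eq_abs]
        exact abs_of_nonneg (by positivity)
      rw [e1, norm_eq_abs, abs_mul, abs_mul, abs_of_pos (by positivity : 0 < 2 / x),
        abs_of_pos (by positivity : 0 < t ^ (s - 1) * exp (-t)),
        show (s - 1 / 2) - 1 = (s - 1) + (-(1 / 2)) by ring, rpow_add ht]
      calc _ ≤ 2 / x * (t ^ (s - 1) * exp (-t) * (√π / 2 * t ^ (-(1 / 2) : ℝ))) := by
            gcongr
            exact hgauss t ht
        _ = _ := by ring
  rw [sinTransform, gamma_mul_integral_eq hs (by fun_prop) fun u => abs_sin_le_one _]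
  simp only [gammaBessel]
  rw [intervalIntegral.integral_of_le zero_le_one, ← integral_integral_swap hprod,
    ← integral_const_mul]
  refine setIntegral_congr_fun measurableSet_Ioi fun t ht => ?_
  rw [← intervalIntegral.integral_of_le zero_le_one, hinner t ht]
  field_simp

/-! ### Analytic properties of `gammaBessel` and its relation to K. -/

/-- One term of the exponential series suffices: e^(-y/t) beats any negative power of t at the
origin, so `gammaBessel` converges for every real order when y > 0. -/
lemma exp_neg_div_le {y t : ℝ} (hy : 0 < y) (ht : 0 < t) (n : ℕ) :
    exp (-(y / t)) ≤ n.factorial / y ^ n * t ^ n := by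
  have h := pow_div_factorial_le_exp (y / t) (by positivity) n
  rw [exp_neg, inv_le_comm₀ (exp_pos _) (by positivity)]
  refine le_trans (le_of_eq ?_) h
  rw [div_pow]
  field_simp

lemma integrableOn_gammaBessel (μ : ℝ) {y : ℝ} (hy : 0 < y) :
    IntegrableOn (fun t : ℝ => t ^ (μ - 1) * exp (-t - y / t)) (Ioi 0) := by
  obtain ⟨n, hn⟩ := exists_nat_gt (-μ)
  have hdom : IntegrableOn
      (fun t : ℝ => n.factorial / y ^ n * (exp (-t) * t ^ ((μ + n) - 1))) (Ioi 0) :=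
    (GammaIntegral_convergent (by linarith)).const_mul _
  refine hdom.mono' (Measurable.aestronglyMeasurable (by fun_prop)) ?_
  filter_upwards [ae_restrict_mem measurableSet_Ioi] with t ht
  have ht : 0 < t := ht
  rw [norm_eq_abs, abs_of_nonneg (by positivity), sub_eq_add_neg (-t), exp_add,
    show μ + n - 1 = (μ - 1) + n by ring, rpow_add ht, rpow_natCast]
  calc _ = t ^ (μ - 1) * exp (-t) * exp (-(y / t)) := by ring
    _ ≤ t ^ (μ - 1) * exp (-t) * (n.factorial / y ^ n * t ^ n) := by
      gcongr
      exact exp_neg_div_le hy ht n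
    _ = _ := by ring

lemma hasDerivAt_gammaBessel (μ : ℝ) {y : ℝ} (hy : 0 < y) :
    HasDerivAt (gammaBessel μ) (-gammaBessel (μ - 1) y) y := by
  have hd := (hasDerivAt_integral_of_dominated_loc_of_deriv_le
    (F := fun y t : ℝ => t ^ (μ - 1) * exp (-t - y / t))
    (F' := fun y t : ℝ => -(t ^ (μ - 1 - 1) * exp (-t - y / t)))
    -- The integrand decreases in y, so its value at y/2 dominates on the neighbourhood (y/2, ∞).
    (bound := fun t : ℝ => t ^ (μ - 1 - 1) * exp (-t - (y / 2) / t))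
    (μ := volume.restrict (Ioi 0)) (x₀ := y)
    (Ioi_mem_nhds (by linarith : y / 2 < y))
    (Eventually.of_forall fun y => Measurable.aestronglyMeasurable (by fun_prop))
    (integrableOn_gammaBessel μ hy) (Measurable.aestronglyMeasurable (by fun_prop))
    ((ae_restrict_mem measurableSet_Ioi).mono fun t ht z hz => ?_)
    (integrableOn_gammaBessel (μ - 1) (by linarith))
    ((ae_restrict_mem measurableSet_Ioi).mono fun t ht z _ => ?_)).2
  · rw [integral_neg] at hd
    exact hd
  · have ht : 0 < t := ht
    have hz : y / 2 < z := hz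
    rw [norm_neg, norm_eq_abs, abs_of_nonneg (by positivity)]
    gcongr
  · have ht : 0 < t := ht
    have h1 : HasDerivAt (fun z : ℝ => -t - z / t) (-(1 / t)) z := by
      simpa using ((hasDerivAt_id z).div_const t).const_sub (-t)
    refine (h1.exp.const_mul (t ^ (μ - 1))).congr_deriv ?_
    rw [rpow_sub_one ht.ne' (μ - 1)]
    ring

lemma continuousOn_gammaBessel {μ : ℝ} (hμ : 0 < μ) : ContinuousOn (gammaBessel μ) (Ici 0) := by
  refine continuousOn_of_dominated (bound := fun t => exp (-t) * t ^ (μ - 1))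
    (fun y _ => Measurable.aestronglyMeasurable (by fun_prop)) (fun y hy => ?_)
    (GammaIntegral_convergent hμ) (ae_of_all _ fun t => by fun_prop)
  filter_upwards [ae_restrict_mem measurableSet_Ioi] with t ht
  have ht : 0 < t := ht
  have hy : 0 ≤ y := hy
  rw [norm_eq_abs, abs_of_nonneg (by positivity), mul_comm]
  gcongr
  have : 0 ≤ y / t := by positivity
  linarith

/-- Substituting t = (x/2)e^u makes the exponent -x cosh u; averaging over u and -u turns e^(μu)
into cosh(μu). -/
lemma gammaBessel_eq_besselK (μ : ℝ) {x : ℝ} (hx : 0 < x) :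
    gammaBessel μ (x ^ 2 / 4) = 2 * (x / 2) ^ μ * besselK μ x := by
  set f : ℝ → ℝ := fun u => x / 2 * exp u with hf
  set F : ℝ → ℝ := fun t => t ^ (μ - 1) * exp (-t - x ^ 2 / 4 / t) with hF
  have himg : f '' univ = Ioi 0 := by
    ext t
    simp only [image_univ, mem_range, mem_Ioi]
    constructor
    · rintro ⟨u, rfl⟩
      positivity
    · intro ht
      refine ⟨log (t / (x / 2)), ?_⟩
      simp only [hf]
      rw [exp_log (by positivity)]
      field_simp
  have hder : ∀ u ∈ (univ : Set ℝ), HasDerivWithinAt f (f u) univ u := fun u _ =>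
    ((Real.hasDerivAt_exp u).const_mul (x / 2)).hasDerivWithinAt
  have hinj : InjOn f univ := fun u _ v _ h =>
    exp_injective (mul_left_cancel₀ (by positivity : x / 2 ≠ 0) h)
  have hpt : ∀ u : ℝ, |f u| • F (f u) = (x / 2) ^ μ * (exp (μ * u) * exp (-x * cosh u)) := by
    intro u
    have hfu : 0 < f u := by simp only [hf]; positivity
    have e1 : -f u - x ^ 2 / 4 / f u = -x * cosh u := by
      rw [cosh_eq, exp_neg]
      simp only [hf]
      field_simp
      ring
    have e2 : f u ^ μ = (x / 2) ^ μ * exp (μ * u) := by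
      simp only [hf]
      rw [mul_rpow (by positivity) (exp_pos _).le, ← exp_mul, mul_comm u]
    simp only [hF]
    rw [e1, abs_of_pos hfu, smul_eq_mul, rpow_sub_one hfu.ne', e2]
    field_simp
  have hint := (integrableOn_image_iff_integrableOn_abs_deriv_smul MeasurableSet.univ hder hinj
    F).1 (by rw [himg]; exact integrableOn_gammaBessel μ (by positivity))
  have heq := integral_image_eq_integral_abs_deriv_smul MeasurableSet.univ hder hinj F
  simp only [hpt] at hint heq
  rw [himg] at heq
  rw [integrableOn_univ] at hint
  rw [Measure.restrict_univ, integral_const_mul] at heq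
  have hint' : Integrable fun u : ℝ => exp (μ * u) * exp (-x * cosh u) := by
    have := hint.const_mul ((x / 2) ^ μ)⁻¹
    refine this.congr (ae_of_all _ fun u => ?_)
    simp only
    rw [inv_mul_cancel_left₀ (by positivity)]
  have hneg : ∫ u : ℝ, exp (μ * -u) * exp (-x * cosh (-u)) =
      ∫ u : ℝ, exp (μ * u) * exp (-x * cosh u) :=
    integral_neg_eq_self (fun u : ℝ => exp (μ * u) * exp (-x * cosh u)) volume
  have hsum := integral_add hint' hint'.comp_neg
  rw [hneg] at hsum
  have hcosh : ∫ u : ℝ, (exp (μ * u) * exp (-x * cosh u) + exp (μ * -u) * exp (-x * cosh (-u))) =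
      2 * ∫ u : ℝ, (fun u => exp (-x * cosh u) * cosh (μ * u)) |u| := by
    rw [← integral_const_mul]
    refine integral_congr_ae (ae_of_all _ fun u => ?_)
    have : cosh (μ * |u|) = cosh (μ * u) := by
      rcases abs_choice u with h | h <;> simp [h]
    simp only [cosh_abs, cosh_neg, this]
    rw [cosh_eq (μ * u)]
    ring_nf
  rw [hcosh, integral_comp_abs (f := fun u => exp (-x * cosh u) * cosh (μ * u))] at hsum
  rw [gammaBessel, heq, besselK]
  linear_combination (-(x / 2) ^ μ / 2) * hsum

lemma besselK_neg (μ x : ℝ) : besselK (-μ) x = besselK μ x := by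
  simp [besselK]

/-- Evenness of K in its order. It turns the order μ - 1 in the derivative into 1 - μ, closing the
system solved below. -/
lemma gammaBessel_neg (μ : ℝ) {y : ℝ} (hy : 0 < y) :
    gammaBessel (-μ) y = y ^ (-μ) * gammaBessel μ y := by
  have hx : 0 < 2 * √y := by positivity
  have hy' : (2 * √y) ^ 2 / 4 = y := by
    rw [mul_pow, sq_sqrt hy.le]; ring
  have h1 := gammaBessel_eq_besselK μ hx
  have h2 := gammaBessel_eq_besselK (-μ) hx
  rw [hy', mul_div_cancel_left₀ _ two_ne_zero] at h1 h2
  rw [h1, h2, besselK_neg, sqrt_eq_rpow, ← rpow_mul hy.le, ← rpow_mul hy.le]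
  have : y ^ (-μ) = y ^ (1 / 2 * -μ) * y ^ (1 / 2 * -μ) := by rw [← rpow_add hy]; ring_nf
  have h3 : y ^ (1 / 2 * -μ) * y ^ (1 / 2 * μ) = 1 := by rw [← rpow_add hy]; simp
  rw [this]
  linear_combination (-2 * y ^ (1 / 2 * -μ) * besselK μ (2 * y ^ (1 / 2 : ℝ))) * h3

/-! ### The Bessel power series and their combination. -/

/-- The entire function `∑ y^k / (k! Γ(k + c))`. -/
def besselSeries (c y : ℝ) : ℝ := ∑' k : ℕ, y ^ k / (k.factorial * Gamma (k + c))

/-- Γ ≥ 1 on [2, ∞); the finitely many smaller arguments are bounded by their sum. Poles are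
harmless, since there `Gamma` is 0 and so is its inverse. -/
lemma exists_bound_one_div_Gamma (c : ℝ) : ∃ M : ℝ, 0 < M ∧ ∀ k : ℕ, |1 / Gamma (k + c)| ≤ M := by
  obtain ⟨N, hN⟩ := exists_nat_ge (2 - c)
  have hpos : 0 ≤ ∑ k ∈ Finset.range N, |1 / Gamma (k + c)| :=
    Finset.sum_nonneg fun _ _ => abs_nonneg _
  refine ⟨1 + ∑ k ∈ Finset.range N, |1 / Gamma (k + c)|, by linarith, fun k => ?_⟩
  rcases lt_or_ge k N with h | h
  · have := Finset.single_le_sum (f := fun k : ℕ => |1 / Gamma (k + c)|)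
      (fun _ _ => abs_nonneg _) (Finset.mem_range.2 h)
    linarith
  · have hk : (2 : ℝ) ≤ k + c := by
      have : (N : ℝ) ≤ k := by exact_mod_cast h
      linarith
    have h1 : 1 ≤ Gamma (k + c) := by
      rw [← Gamma_two]
      exact Gamma_strictMonoOn_Ici.monotoneOn self_mem_Ici hk hk
    rw [abs_of_pos (by positivity), div_le_iff₀ (by positivity)]
    nlinarith

lemma summable_besselSeries (c y : ℝ) :
    Summable fun k : ℕ => y ^ k / (k.factorial * Gamma (k + c)) := by
  obtain ⟨M, hM, hb⟩ := exists_bound_one_div_Gamma c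
  refine Summable.of_norm_bounded ((summable_pow_div_factorial |y|).mul_right M) fun k => ?_
  rw [div_mul_eq_div_mul_one_div, norm_mul, norm_div, norm_pow, norm_eq_abs, norm_eq_abs,
    norm_eq_abs, Nat.abs_cast]
  gcongr
  exact hb k

lemma hasSum_deriv_besselSeries (c y : ℝ) :
    HasSum (fun k : ℕ => k * y ^ (k - 1) / (k.factorial * Gamma (k + c)))
      (besselSeries (c + 1) y) := by
  rw [← hasSum_nat_add_iff' 1]
  simp only [Finset.range_one, Finset.sum_singleton, CharP.cast_eq_zero, zero_mul, zero_div,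
    sub_zero]
  refine (summable_besselSeries (c + 1) y).hasSum.congr_fun fun k => ?_
  rw [Nat.factorial_succ, Nat.add_sub_cancel]
  push_cast
  rw [show (k : ℝ) + 1 + c = k + (c + 1) by ring, mul_assoc, mul_div_mul_left _ _ (by positivity)]

lemma hasDerivAt_besselSeries (c y : ℝ) :
    HasDerivAt (besselSeries c) (besselSeries (c + 1) y) y := by
  obtain ⟨M, hM, hb⟩ := exists_bound_one_div_Gamma c
  set R := |y| + 1
  have hu : Summable fun k : ℕ => k * R ^ (k - 1) / k.factorial * M := by
    refine Summable.mul_right M ((summable_nat_add_iff 1).1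
      ((summable_pow_div_factorial R).congr fun k => ?_))
    rw [Nat.factorial_succ, Nat.add_sub_cancel]
    push_cast
    rw [mul_div_mul_left _ _ (by positivity)]
  have hy : y ∈ Metric.ball (0 : ℝ) R := by simp [R]
  have h := hasDerivAt_tsum_of_isPreconnected hu Metric.isOpen_ball
    (convex_ball (0 : ℝ) R).isPreconnected
    (g := fun (k : ℕ) (y : ℝ) => y ^ k / (k.factorial * Gamma (k + c)))
    (g' := fun (k : ℕ) (y : ℝ) => k * y ^ (k - 1) / (k.factorial * Gamma (k + c)))
    (fun k z _ => (hasDerivAt_pow k z).div_const _) (fun k z hz => ?_) hy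
    (summable_besselSeries c y) hy
  · rw [(hasSum_deriv_besselSeries c y).tsum_eq] at h
    exact h
  · have hz : |z| ≤ R := by simpa using (mem_ball_zero_iff.1 hz).le
    rw [div_mul_eq_div_mul_one_div, norm_mul, norm_div, norm_mul, norm_pow, norm_eq_abs,
      norm_eq_abs, norm_eq_abs, norm_eq_abs, Nat.abs_cast, Nat.abs_cast]
    gcongr
    exact hb k

lemma continuous_besselSeries (c : ℝ) : Continuous (besselSeries c) :=
  continuous_iff_continuousAt.2 fun y => (hasDerivAt_besselSeries c y).continuousAt

lemma besselSeries_zero (c : ℝ) : besselSeries c 0 = 1 / Gamma c := by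
  rw [besselSeries, tsum_eq_single 0 fun k hk => by simp [hk]]
  simp

lemma one_div_Gamma_eq (s : ℝ) : 1 / Gamma s = s * (1 / Gamma (s + 1)) := by
  rcases eq_or_ne s 0 with rfl | hs
  · simp
  · rw [Gamma_add_one hs]
    rcases eq_or_ne (Gamma s) 0 with h | h
    · simp [h]
    · field_simp

/-- Termwise 1/Γ(k+c) = (k+c)/Γ(k+c+1): the summand c gives the first term, the summand k gives y
times a derivative. -/
lemma besselSeries_eq_add (c y : ℝ) :
    besselSeries c y = c * besselSeries (c + 1) y + y * besselSeries (c + 2) y := by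
  have h1 := (summable_besselSeries (c + 1) y).hasSum.mul_left c
  have h2 := (hasSum_deriv_besselSeries (c + 1) y).mul_left y
  refine ((h1.add h2).congr_fun fun k => ?_).tsum_eq.trans ?_
  · rw [div_mul_eq_div_mul_one_div, one_div_Gamma_eq, ← add_assoc]
    rcases k with _ | k
    · simp
    · rw [Nat.add_sub_cancel, pow_succ]
      push_cast
      ring
  · rw [show c + 1 + 1 = c + 2 by ring]
    rfl

/-- The combination of Bessel series that represents `gammaBessel μ` for noninteger `μ`. -/
def gammaBesselSeries (μ y : ℝ) : ℝ :=
  π / sin (π * μ) * (besselSeries (1 - μ) y - y ^ μ * besselSeries (1 + μ) y)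

/-- The same rule as for `gammaBessel`: the contiguous relation `besselSeries_eq_add` recombines the
product rule, and the sign comes from sin(π(μ-1)) = -sin(πμ). -/
lemma hasDerivAt_gammaBesselSeries (μ : ℝ) {y : ℝ} (hy : 0 < y) :
    HasDerivAt (gammaBesselSeries μ) (-gammaBesselSeries (μ - 1) y) y := by
  have h1 := hasDerivAt_besselSeries (1 - μ) y
  have h2 := (hasDerivAt_rpow_const (p := μ) (Or.inl hy.ne')).mul
    (hasDerivAt_besselSeries (1 + μ) y)
  refine ((h1.sub h2).const_mul (π / sin (π * μ))).congr_deriv ?_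
  have hs : sin (π * (μ - 1)) = -sin (π * μ) := by
    rw [mul_sub, mul_one, sin_sub_pi]
  rw [gammaBesselSeries, hs, div_neg, neg_mul, neg_neg, show 1 - (μ - 1) = 1 - μ + 1 by ring,
    show 1 + (μ - 1) = μ by ring, besselSeries_eq_add μ, rpow_sub_one hy.ne',
    show 1 + μ + 1 = μ + 2 by ring, show 1 + μ = μ + 1 by ring]
  field_simp

lemma gammaBesselSeries_neg (μ : ℝ) {y : ℝ} (hy : 0 < y) :
    gammaBesselSeries (-μ) y = y ^ (-μ) * gammaBesselSeries μ y := by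
  have h : y ^ (-μ) * y ^ μ = 1 := by rw [← rpow_add hy]; simp
  rw [gammaBesselSeries, gammaBesselSeries, mul_neg, sin_neg, sub_neg_eq_add, ← sub_eq_add_neg]
  rw [div_neg]
  linear_combination (π / sin (π * μ) * besselSeries (1 + μ) y) * h

lemma gammaBesselSeries_zero {μ : ℝ} (hμ : 0 < μ) (hn : ∀ n : ℤ, μ ≠ n) :
    gammaBesselSeries μ 0 = Gamma μ := by
  have hG : Gamma (1 - μ) ≠ 0 := Gamma_ne_zero fun m h => hn (m + 1) (by push_cast; linarith)
  rw [gammaBesselSeries, ← Gamma_mul_Gamma_one_sub, besselSeries_zero, zero_rpow hμ.ne']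
  field_simp
  ring

lemma continuousOn_gammaBesselSeries {μ : ℝ} (hμ : 0 < μ) :
    ContinuousOn (gammaBesselSeries μ) (Ici 0) := by
  have h1 := continuous_besselSeries (1 - μ)
  have h2 := continuous_besselSeries (1 + μ)
  have h3 := continuous_rpow_const hμ.le
  exact (continuous_const.mul (h1.sub (h3.mul h2))).continuousOn

/-! ### Identification of `gammaBessel` with the series by uniqueness. -/

/-- A Gronwall-type energy argument. With Φ' = y^(μ-1) + y^(-μ), the energy (a² + b²)e^(-Φ) has
derivative -Φ'(a + b)²e^(-Φ) ≤ 0 and starts at 0. Since 0 < μ < 1, both singular coefficients are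
integrable at 0, so Φ is continuous there. -/
lemma eq_zero_of_coupled_system {μ : ℝ} (h0 : 0 < μ) (h1 : μ < 1) {a b : ℝ → ℝ}
    (ha : ContinuousOn a (Ici 0)) (hb : ContinuousOn b (Ici 0)) (ha0 : a 0 = 0) (hb0 : b 0 = 0)
    (had : ∀ y, 0 < y → HasDerivAt a (-(y ^ (μ - 1) * b y)) y)
    (hbd : ∀ y, 0 < y → HasDerivAt b (-(y ^ (-μ) * a y)) y) {y : ℝ} (hy : 0 ≤ y) : a y = 0 := by
  set Φ : ℝ → ℝ := fun y => y ^ μ / μ + y ^ (1 - μ) / (1 - μ) with hΦ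
  set E : ℝ → ℝ := fun y => (a y ^ 2 + b y ^ 2) * exp (-Φ y) with hE
  have hΦc : Continuous Φ := by
    have h1 := continuous_rpow_const h0.le
    have h2 := continuous_rpow_const (q := 1 - μ) (by linarith)
    exact (h1.div_const _).add (h2.div_const _)
  have hEc : ContinuousOn E (Ici 0) :=
    ((ha.pow 2).add (hb.pow 2)).mul (by fun_prop)
  have hEd : ∀ y, 0 < y → HasDerivAt E
      (-((y ^ (μ - 1) + y ^ (-μ)) * (a y + b y) ^ 2) * exp (-Φ y)) y := by
    intro y hy
    have e1 := (hasDerivAt_rpow_const (p := μ) (Or.inl hy.ne')).div_const μ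
    have e2 := (hasDerivAt_rpow_const (p := 1 - μ) (Or.inl hy.ne')).div_const (1 - μ)
    have hΦd : HasDerivAt Φ (y ^ (μ - 1) + y ^ (-μ)) y := by
      refine (e1.add e2).congr_deriv ?_
      rw [show 1 - μ - 1 = -μ by ring, mul_div_cancel_left₀ _ h0.ne',
        mul_div_cancel_left₀ _ (by linarith : (1 : ℝ) - μ ≠ 0)]
    refine ((((had y hy).pow 2).add ((hbd y hy).pow 2)).mul hΦd.neg.exp).congr_deriv ?_
    simp only [Pi.add_apply, Pi.pow_apply, Pi.neg_apply]
    ring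
  have hanti : AntitoneOn E (Ici 0) := by
    refine antitoneOn_of_deriv_nonpos (convex_Ici 0) hEc (fun y hy => ?_) fun y hy => ?_
    · rw [interior_Ici] at hy
      exact (hEd y hy).differentiableAt.differentiableWithinAt
    · rw [interior_Ici] at hy
      rw [(hEd y hy).deriv, neg_mul]
      have : 0 < y := hy
      have : 0 ≤ (y ^ (μ - 1) + y ^ (-μ)) * (a y + b y) ^ 2 * exp (-Φ y) := by positivity
      linarith
  have hle := hanti self_mem_Ici hy hy
  simp only [hE, ha0, hb0] at hle
  have hexp := exp_pos (-Φ y)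
  have : a y ^ 2 + b y ^ 2 ≤ 0 := by
    by_contra hlt
    have := mul_pos (not_le.1 hlt) hexp
    linarith [zero_mul (exp (-Φ 0))]
  nlinarith [sq_nonneg (b y), sq_nonneg (a y)]

/-- The differences at orders μ and 1 - μ differentiate into each other and vanish at 0, where both
functions equal Γ. -/
lemma gammaBessel_eq_series_of_lt_one {μ : ℝ} (h0 : 0 < μ) (h1 : μ < 1) {y : ℝ} (hy : 0 ≤ y) :
    gammaBessel μ y = gammaBesselSeries μ y := by
  have hn : ∀ c : ℝ, 0 < c → c < 1 → ∀ n : ℤ, c ≠ n := by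
    rintro c hc0 hc1 n rfl
    have h2 : 0 < n := by exact_mod_cast hc0
    have h3 : n < 1 := by exact_mod_cast hc1
    omega
  have hderiv : ∀ c y : ℝ, 0 < y → HasDerivAt (fun y => gammaBessel c y - gammaBesselSeries c y)
      (-(y ^ (c - 1) * (gammaBessel (1 - c) y - gammaBesselSeries (1 - c) y))) y := by
    intro c y hy
    refine ((hasDerivAt_gammaBessel c hy).sub (hasDerivAt_gammaBesselSeries c hy)).congr_deriv ?_
    have e1 := gammaBessel_neg (1 - c) hy
    have e2 := gammaBesselSeries_neg (1 - c) hy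
    rw [neg_sub] at e1 e2
    rw [e1, e2]
    ring
  have h := eq_zero_of_coupled_system h0 h1
    ((continuousOn_gammaBessel h0).sub (continuousOn_gammaBesselSeries h0))
    ((continuousOn_gammaBessel (μ := 1 - μ) (by linarith)).sub
      (continuousOn_gammaBesselSeries (by linarith)))
    (by rw [Pi.sub_apply, gammaBessel_zero h0, gammaBesselSeries_zero h0 (hn μ h0 h1), sub_self])
    (by rw [Pi.sub_apply, gammaBessel_zero (by linarith),
      gammaBesselSeries_zero (by linarith) (hn _ (by linarith) (by linarith)), sub_self])
    (fun y hy => hderiv μ y hy)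
    (fun y hy => by
      have := hderiv (1 - μ) y hy
      rw [show 1 - (1 - μ) = μ by ring, show 1 - μ - 1 = -μ by ring] at this
      exact this) hy
  exact sub_eq_zero.1 h

/-- Induction on the integer part: the derivative of the difference is minus the difference at order
μ - 1, which is zero, and the values at 0 agree. -/
lemma gammaBessel_eq_series_of_pos (n : ℕ) {μ : ℝ} (h0 : n < μ) (h1 : μ < n + 1) {y : ℝ}
    (hy : 0 ≤ y) : gammaBessel μ y = gammaBesselSeries μ y := by
  induction n generalizing μ y with
  | zero => exact gammaBessel_eq_series_of_lt_one (by simpa using h0) (by simpa using h1) hy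
  | succ n ih =>
    push_cast at h0 h1
    have hμ : 0 < μ := by linarith [(Nat.cast_nonneg n : (0 : ℝ) ≤ n)]
    have hn : ∀ m : ℤ, μ ≠ m := by
      rintro m rfl
      have h2 : (n : ℤ) + 1 < m := by exact_mod_cast h0
      have h3 : m < (n : ℤ) + 1 + 1 := by exact_mod_cast h1
      omega
    have h := intervalIntegral.integral_eq_sub_of_hasDerivAt_of_le hy
      (f := fun y => gammaBessel μ y - gammaBesselSeries μ y) (f' := fun _ => 0)
      (((continuousOn_gammaBessel hμ).sub (continuousOn_gammaBesselSeries hμ)).mono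
        Icc_subset_Ici_self) (fun z hz => ?_) (by simp)
    · simp only [gammaBessel_zero hμ, gammaBesselSeries_zero hμ hn,
        intervalIntegral.integral_zero] at h
      linarith
    · refine ((hasDerivAt_gammaBessel μ hz.1).sub
        (hasDerivAt_gammaBesselSeries μ hz.1)).congr_deriv ?_
      rw [ih (μ := μ - 1) (by linarith) (by linarith) hz.1.le]
      ring

lemma gammaBessel_eq_series {μ : ℝ} (hμ : -1 < μ) (hn : ∀ n : ℤ, μ ≠ n) {y : ℝ} (hy : 0 < y) :
    gammaBessel μ y = gammaBesselSeries μ y := by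
  rcases lt_or_gt_of_ne (by exact_mod_cast hn 0 : μ ≠ 0) with h | h
  · have e1 := gammaBessel_neg (-μ) hy
    have e2 := gammaBesselSeries_neg (-μ) hy
    rw [neg_neg] at e1 e2
    rw [e1, e2, gammaBessel_eq_series_of_lt_one (by linarith) (by linarith) hy.le]
  · refine gammaBessel_eq_series_of_pos ⌊μ⌋₊ ?_ (Nat.lt_floor_add_one μ) hy.le
    exact lt_of_le_of_ne (Nat.floor_le h.le) fun h' => hn ⌊μ⌋₊ (by exact_mod_cast h'.symm)

/-! ### The sine transform when ν is not an odd integer. -/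

lemma one_sub_sq_pos {v : ℝ} (hv : v ∈ Ioo (0 : ℝ) 1) : 0 < 1 - v ^ 2 := by
  nlinarith [hv.1, hv.2]

/-- A Beta integral obtained from the cosine transform at 0: the substitution u = v(1-v²)^(-1/2)
satisfies 1 + u² = (1-v²)^(-1). -/
lemma one_sub_sq_rpow_integral {p : ℝ} (hp : -1 < p) :
    IntegrableOn (fun v : ℝ => (1 - v ^ 2) ^ p) (Ioo 0 1) ∧
      ∫ v in Ioo (0 : ℝ) 1, (1 - v ^ 2) ^ p = √π / 2 * (Gamma (p + 1) / Gamma (p + 3 / 2)) := by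
  set f : ℝ → ℝ := fun v => v * (1 - v ^ 2) ^ (-(1 / 2) : ℝ) with hf
  have hder : ∀ v ∈ Ioo (0 : ℝ) 1,
      HasDerivWithinAt f ((1 - v ^ 2) ^ (-(3 / 2) : ℝ)) (Ioo 0 1) v := by
    intro v hv
    have hw := one_sub_sq_pos hv
    have h1 : HasDerivAt (fun v : ℝ => 1 - v ^ 2) (-(2 * v)) v := by
      simpa using (hasDerivAt_pow 2 v).const_sub 1
    have h2 := (hasDerivAt_id v).mul (h1.rpow_const (p := (-(1 / 2) : ℝ)) (Or.inl hw.ne'))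
    refine (h2.congr_deriv ?_).hasDerivWithinAt
    have e : (1 - v ^ 2) ^ (-(1 / 2) : ℝ) = (1 - v ^ 2) * (1 - v ^ 2) ^ (-(3 / 2) : ℝ) := by
      rw [← rpow_one_add' hw.le (by norm_num)]; norm_num
    rw [show (-(1 / 2) : ℝ) - 1 = -(3 / 2) by norm_num, e]
    simp only [id]
    ring
  have hsq : ∀ v ∈ Ioo (0 : ℝ) 1, 1 + f v ^ 2 = (1 - v ^ 2)⁻¹ := by
    intro v hv
    have hw := one_sub_sq_pos hv
    have : ((1 - v ^ 2) ^ (-(1 / 2) : ℝ)) ^ 2 = (1 - v ^ 2)⁻¹ := by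
      rw [← rpow_natCast, ← rpow_mul hw.le]
      norm_num
      rw [rpow_neg_one]
    simp only [hf]
    rw [mul_pow, this]
    field_simp
    ring
  have hpos : ∀ v ∈ Ioo (0 : ℝ) 1, 0 < f v := fun v hv =>
    mul_pos hv.1 (rpow_pos_of_pos (one_sub_sq_pos hv) _)
  have hinj : InjOn f (Ioo 0 1) := by
    intro a ha b hb hab
    have h1 := hsq a ha
    rw [hab, hsq b hb, inv_inj] at h1
    nlinarith [ha.1, hb.1]
  have himg : f '' Ioo 0 1 = Ioi 0 := by
    ext u
    constructor
    · rintro ⟨v, hv, rfl⟩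
      exact hpos v hv
    · intro hu
      have hu : 0 < u := hu
      have hu1 : 0 < √(1 + u ^ 2) := by positivity
      have hs : √(1 + u ^ 2) ^ 2 = 1 + u ^ 2 := sq_sqrt (by positivity)
      have hv : u / √(1 + u ^ 2) ∈ Ioo (0 : ℝ) 1 := by
        refine ⟨by positivity, (div_lt_one hu1).2 ?_⟩
        exact lt_sqrt_of_sq_lt (by linarith)
      refine ⟨_, hv, ?_⟩
      have h1 := hsq _ hv
      have h2 := hpos _ hv
      have h3 : (1 - (u / √(1 + u ^ 2)) ^ 2)⁻¹ = 1 + u ^ 2 := by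
        rw [div_pow, hs]
        have : (1 : ℝ) + u ^ 2 ≠ 0 := by positivity
        field_simp
        ring
      rw [h3] at h1
      nlinarith
  have hs : 1 / 2 < p + 3 / 2 := by linarith
  have hpt : ∀ v ∈ Ioo (0 : ℝ) 1, |(1 - v ^ 2) ^ (-(3 / 2) : ℝ)| •
      (1 + f v ^ 2) ^ (-(p + 3 / 2)) = (1 - v ^ 2) ^ p := by
    intro v hv
    have hw := one_sub_sq_pos hv
    rw [hsq v hv, abs_of_pos (rpow_pos_of_pos hw _), inv_rpow hw.le, rpow_neg hw.le (p + 3 / 2),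
      inv_inv, smul_eq_mul, ← rpow_add hw]
    ring_nf
  have hint := (integrableOn_image_iff_integrableOn_abs_deriv_smul measurableSet_Ioo hder hinj
    (fun u => (1 + u ^ 2) ^ (-(p + 3 / 2)))).1
      (by rw [himg]; exact (integrable_one_add_sq_rpow hs).integrableOn)
  have heq := integral_image_eq_integral_abs_deriv_smul measurableSet_Ioo hder hinj
    (fun u => (1 + u ^ 2) ^ (-(p + 3 / 2)))
  refine ⟨hint.congr_fun hpt measurableSet_Ioo, ?_⟩
  rw [setIntegral_congr_fun measurableSet_Ioo hpt, himg] at heq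
  rw [← heq]
  have h := gamma_mul_cosTransform hs 0
  have hG : Gamma (p + 3 / 2) ≠ 0 := (Gamma_pos_of_pos (by linarith)).ne'
  simp only [cosTransform, zero_mul, cos_zero, one_mul, ne_eq, OfNat.ofNat_ne_zero,
    not_false_eq_true, zero_pow, zero_div] at h
  rw [gammaBessel_zero (by linarith), show p + 3 / 2 - 1 / 2 = p + 1 by ring] at h
  rw [mul_div_assoc', eq_div_iff hG, mul_comm]
  exact h

lemma integrableOn_rpow_mul_besselSeries {q : ℝ} (hq : -1 < q) (c z : ℝ) :
    IntegrableOn (fun v : ℝ => (1 - v ^ 2) ^ q * besselSeries c (z ^ 2 * (1 - v ^ 2)))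
      (Ioo 0 1) := by
  rw [← integrableOn_Icc_iff_integrableOn_Ioo]
  refine IntegrableOn.mul_continuousOn ?_ ?_ isCompact_Icc
  · rw [integrableOn_Icc_iff_integrableOn_Ioo]
    exact (one_sub_sq_rpow_integral hq).1
  · have := continuous_besselSeries c
    fun_prop

/-- Termwise integration is licensed by (1-v²)^k ≤ 1, which bounds each term by that of the series
at z² times a fixed integral. -/
lemma hasSum_integral_rpow_mul_besselSeries {q : ℝ} (hq : -1 < q) (c z : ℝ) :
    HasSum (fun k : ℕ => z ^ (2 * k) / (k.factorial * Gamma (k + c)) *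
        (√π / 2 * (Gamma (k + q + 1) / Gamma (k + q + 3 / 2))))
      (∫ v in Ioo (0 : ℝ) 1, (1 - v ^ 2) ^ q * besselSeries c (z ^ 2 * (1 - v ^ 2))) := by
  have hq' : ∀ k : ℕ, -1 < k + q := fun k => by
    have : (0 : ℝ) ≤ k := k.cast_nonneg
    linarith
  have hF : ∀ k : ℕ, IntegrableOn (fun v : ℝ => z ^ (2 * k) / (k.factorial * Gamma (k + c)) *
      (1 - v ^ 2) ^ (k + q)) (Ioo 0 1) := fun k =>
    (one_sub_sq_rpow_integral (hq' k)).1.const_mul _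
  have h := hasSum_integral_of_summable_integral_norm hF ?_
  · have hval : ∫ v in Ioo (0 : ℝ) 1, (1 - v ^ 2) ^ q * besselSeries c (z ^ 2 * (1 - v ^ 2)) =
        ∫ v in Ioo (0 : ℝ) 1, ∑' k : ℕ, z ^ (2 * k) / (k.factorial * Gamma (k + c)) *
          (1 - v ^ 2) ^ (k + q) := by
      refine setIntegral_congr_fun measurableSet_Ioo fun v hv => ?_
      have hw := one_sub_sq_pos hv
      rw [besselSeries, ← tsum_mul_left]
      refine tsum_congr fun k => ?_
      rw [rpow_add hw, rpow_natCast, mul_pow, ← pow_mul]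
      ring
    rw [hval]
    refine h.congr_fun fun k => ?_
    rw [integral_const_mul, (one_sub_sq_rpow_integral (hq' k)).2]
  · refine Summable.of_nonneg_of_le (fun k => integral_nonneg fun v => norm_nonneg _)
      (fun k => ?_) ((summable_besselSeries c (z ^ 2)).abs.mul_right
        (∫ v in Ioo (0 : ℝ) 1, (1 - v ^ 2) ^ q))
    rw [← integral_const_mul]
    refine setIntegral_mono_on (hF k).norm ((one_sub_sq_rpow_integral hq).1.const_mul _)
      measurableSet_Ioo fun v hv => ?_
    have hw := one_sub_sq_pos hv
    rw [norm_mul, ← pow_mul, norm_eq_abs, norm_eq_abs,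
      abs_of_pos (rpow_pos_of_pos hw _), rpow_add hw, rpow_natCast]
    gcongr
    exact mul_le_of_le_one_left (rpow_pos_of_pos hw _).le
      (pow_le_one₀ hw.le (by nlinarith [sq_nonneg v]))

/-- The sine transform in terms of Bessel and Struve functions, when `ν` is not an odd integer. -/
lemma gamma_mul_sinTransform_eq_bessel_struve {ν x : ℝ} (hν : 0 < ν)
    (hodd : ∀ m : ℕ, ν ≠ 2 * m + 1) (hx : 0 < x) :
    Gamma ((ν + 1) / 2) * sinTransform ((ν + 1) / 2) x =
      √π / 2 * (π / cos (π * ν / 2)) * (x / 2) ^ (ν / 2) *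
        (besselI (ν / 2) x - struveL (-(ν / 2)) x) := by
  set μ := (ν - 1) / 2 with hμ
  set z := x / 2 with hz
  have hz0 : 0 < z := by positivity
  have hμ1 : -1 < μ := by rw [hμ]; linarith
  have hn : ∀ n : ℤ, μ ≠ n := by
    intro n h
    have h1 : ν = 2 * n + 1 := by rw [← h, hμ]; ring
    have h2 : -1 < n := by
      have : (-1 : ℝ) < n := by linarith
      exact_mod_cast this
    obtain ⟨m, rfl⟩ := Int.eq_ofNat_of_zero_le (by omega : 0 ≤ n)
    exact hodd m (by simpa using h1)
  have h1 := hasSum_integral_rpow_mul_besselSeries (q := 0) (by norm_num) (1 - μ) z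
  have h2 := hasSum_integral_rpow_mul_besselSeries hμ1 (1 + μ) z
  have hI1 := integrableOn_rpow_mul_besselSeries (q := 0) (by norm_num) (1 - μ) z
  have hI2 := (integrableOn_rpow_mul_besselSeries hμ1 (1 + μ) z).const_mul (z ^ (2 * μ))
  have hint : ∫ v in (0 : ℝ)..1, gammaBessel μ (x ^ 2 * (1 - v ^ 2) / 4) =
      π / sin (π * μ) * ((∫ v in Ioo (0 : ℝ) 1, (1 - v ^ 2) ^ (0 : ℝ) *
        besselSeries (1 - μ) (z ^ 2 * (1 - v ^ 2))) - z ^ (2 * μ) *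
        ∫ v in Ioo (0 : ℝ) 1, (1 - v ^ 2) ^ μ * besselSeries (1 + μ) (z ^ 2 * (1 - v ^ 2))) := by
    rw [intervalIntegral.integral_of_le zero_le_one, integral_Ioc_eq_integral_Ioo,
      ← integral_const_mul, ← integral_sub hI1 hI2, ← integral_const_mul]
    refine setIntegral_congr_fun measurableSet_Ioo fun v hv => ?_
    have hw := one_sub_sq_pos hv
    rw [show x ^ 2 * (1 - v ^ 2) / 4 = z ^ 2 * (1 - v ^ 2) by rw [hz]; ring,
      gammaBessel_eq_series hμ1 hn (by positivity), gammaBesselSeries, rpow_zero, one_mul,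
      mul_rpow (by positivity) hw.le, ← rpow_natCast, ← rpow_mul hz0.le]
    push_cast
    ring
  -- The k! of the series cancels the Γ(k+1) of the Beta integral; Γ(k+3/2) and Γ(k+1-μ) remain, as
  -- in the Struve series of order -ν/2.
  have hL : z * ∫ v in Ioo (0 : ℝ) 1, (1 - v ^ 2) ^ (0 : ℝ) *
      besselSeries (1 - μ) (z ^ 2 * (1 - v ^ 2)) =
      √π / 2 * (z ^ (ν / 2) * struveL (-(ν / 2)) x) := by
    rw [← h1.tsum_eq, struveL, ← tsum_mul_left, ← tsum_mul_left, ← tsum_mul_left]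
    refine tsum_congr fun k => ?_
    have e1 : z ^ (ν / 2) * z ^ (2 * (k : ℝ) + -(ν / 2) + 1) = z * z ^ (2 * k) := by
      rw [← rpow_add hz0, ← rpow_natCast, ← rpow_one_add' hz0.le (by positivity)]
      push_cast
      ring_nf
    rw [← hz, mul_div_assoc' (z ^ (ν / 2)), e1, add_zero, Gamma_nat_eq_factorial,
      show (k : ℝ) + -(ν / 2) + 3 / 2 = k + (1 - μ) by rw [hμ]; ring]
    have : (k.factorial : ℝ) ≠ 0 := by positivity
    field_simp
  -- Here Γ(k+1+μ) cancels instead, leaving k! and Γ(k+μ+3/2) = Γ(k+ν/2+1).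
  have hI : z * (z ^ (2 * μ) * ∫ v in Ioo (0 : ℝ) 1, (1 - v ^ 2) ^ μ *
      besselSeries (1 + μ) (z ^ 2 * (1 - v ^ 2))) = √π / 2 * (z ^ (ν / 2) * besselI (ν / 2) x) := by
    rw [← h2.tsum_eq, besselI, ← tsum_mul_left, ← tsum_mul_left, ← tsum_mul_left, ← tsum_mul_left]
    refine tsum_congr fun k => ?_
    have e1 : z ^ (ν / 2) * z ^ (2 * (k : ℝ) + ν / 2) = z * z ^ (2 * μ) * z ^ (2 * k) := by
      rw [← rpow_natCast, mul_assoc, ← rpow_add hz0, ← rpow_add hz0,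
        ← rpow_one_add' hz0.le (by rw [hμ]; push_cast; ring_nf; positivity)]
      push_cast
      rw [hμ]
      ring_nf
    have hG : Gamma (k + μ + 1) ≠ 0 := (Gamma_pos_of_pos (by
      linarith [(Nat.cast_nonneg k : (0 : ℝ) ≤ k)])).ne'
    rw [← hz, mul_div_assoc' (z ^ (ν / 2)), e1, show (k : ℝ) + (1 + μ) = k + μ + 1 by ring,
      show (k : ℝ) + ν / 2 + 1 = k + μ + 3 / 2 by rw [hμ]; ring]
    field_simp
  have hsin : sin (π * μ) = -cos (π * ν / 2) := by
    rw [hμ, ← sin_sub_pi_div_two]; ring_nf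
  rw [gamma_mul_sinTransform (by linarith) hx, show (ν + 1) / 2 - 1 = μ by rw [hμ]; ring, hint,
    hsin, div_neg]
  linear_combination (π / cos (π * ν / 2)) * hI - (π / cos (π * ν / 2)) * hL

/-! ### Differential recurrences for the sine transform in s. -/

lemma abs_one_add_sq_rpow (s u : ℝ) : |(1 + u ^ 2) ^ (-s)| = (1 + u ^ 2) ^ (-s) :=
  abs_of_nonneg (by positivity)

lemma mul_one_add_sq_rpow_le (s u : ℝ) :
    u * (1 + u ^ 2) ^ (-s) ≤ (1 + u ^ 2) ^ (-(s - 1 / 2)) := by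
  have h1 : u ≤ (1 + u ^ 2) ^ (1 / 2 : ℝ) := by
    rw [← sqrt_eq_rpow]
    exact le_sqrt_of_sq_le (by linarith)
  calc u * (1 + u ^ 2) ^ (-s) ≤ (1 + u ^ 2) ^ (1 / 2 : ℝ) * (1 + u ^ 2) ^ (-s) := by gcongr
    _ = _ := by rw [← rpow_add (by positivity)]; ring_nf

lemma integrableOn_id_mul_one_add_sq_rpow {s : ℝ} (hs : 1 < s) :
    IntegrableOn (fun u : ℝ => u * (1 + u ^ 2) ^ (-s)) (Ioi 0) := by
  have hc := continuous_one_add_sq_rpow s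
  refine (integrable_one_add_sq_rpow (s := s - 1 / 2) (by linarith)).integrableOn.mono'
    (by fun_prop) ?_
  filter_upwards [ae_restrict_mem measurableSet_Ioi] with u hu
  have hu : 0 < u := hu
  rw [norm_eq_abs, abs_of_nonneg (by positivity)]
  exact mul_one_add_sq_rpow_le s u

/-- The half-line cosine transform of `u (1 + u²)^(-s)`, the derivative of `sinTransform s`. -/
def cosMoment (s x : ℝ) : ℝ := ∫ u in Ioi (0 : ℝ), cos (x * u) * (u * (1 + u ^ 2) ^ (-s))

lemma hasDerivAt_sinTransform {s : ℝ} (hs : 1 < s) (x : ℝ) :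
    HasDerivAt (sinTransform s) (cosMoment s x) x := by
  have hc := continuous_one_add_sq_rpow s
  refine (hasDerivAt_integral_of_dominated_loc_of_deriv_le
    (F := fun x u => sin (x * u) * (1 + u ^ 2) ^ (-s))
    (F' := fun x u => cos (x * u) * (u * (1 + u ^ 2) ^ (-s)))
    (bound := fun u => u * (1 + u ^ 2) ^ (-s)) (μ := volume.restrict (Ioi 0)) (x₀ := x)
    univ_mem (Eventually.of_forall fun y => by fun_prop)
    (integrableOn_mul_one_add_sq_rpow (by linarith) (by fun_prop) fun u => abs_sin_le_one _)
    (by fun_prop)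
    ((ae_restrict_mem measurableSet_Ioi).mono fun u hu y _ => ?_)
    (integrableOn_id_mul_one_add_sq_rpow hs) (ae_of_all _ fun u y _ => ?_)).2
  · have hu : 0 < u := hu
    rw [norm_mul, norm_eq_abs, norm_eq_abs, abs_of_nonneg (by positivity : 0 ≤ u * _)]
    exact mul_le_of_le_one_left (by positivity) (abs_cos_le_one _)
  · have h1 : HasDerivAt (fun y : ℝ => y * u) u y := by simpa using (hasDerivAt_id y).mul_const u
    exact (h1.sin.mul_const _).congr_deriv (by ring)

lemma sq_mul_one_add_sq_rpow (s u : ℝ) :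
    u ^ 2 * (1 + u ^ 2) ^ (-s) = (1 + u ^ 2) ^ (-(s - 1)) - (1 + u ^ 2) ^ (-s) := by
  rw [show -(s - 1) = -s + 1 by ring, rpow_add_one (by positivity)]
  ring

lemma hasDerivAt_cosMoment {s : ℝ} (hs : 3 / 2 < s) (x : ℝ) :
    HasDerivAt (cosMoment s) (sinTransform s x - sinTransform (s - 1) x) x := by
  have hc := continuous_one_add_sq_rpow s
  have hi1 := integrableOn_mul_one_add_sq_rpow (s := s) (by linarith) (φ := fun u => sin (x * u))
    (by fun_prop) fun u => abs_sin_le_one _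
  have hi2 := integrableOn_mul_one_add_sq_rpow (s := s - 1) (by linarith)
    (φ := fun u => sin (x * u)) (by fun_prop) fun u => abs_sin_le_one _
  have hd := (hasDerivAt_integral_of_dominated_loc_of_deriv_le
    (F := fun x u => cos (x * u) * (u * (1 + u ^ 2) ^ (-s)))
    (F' := fun x u => -(sin (x * u) * (u ^ 2 * (1 + u ^ 2) ^ (-s))))
    (bound := fun u => (1 + u ^ 2) ^ (-(s - 1))) (μ := volume.restrict (Ioi 0)) (x₀ := x)
    univ_mem (Eventually.of_forall fun y => by fun_prop)
    ((integrableOn_id_mul_one_add_sq_rpow (by linarith)).bdd_mul (by fun_prop) (c := 1)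
      (ae_of_all _ fun u => abs_cos_le_one _))
    (by fun_prop) (ae_of_all _ fun u y _ => ?_)
    (integrable_one_add_sq_rpow (by linarith)).integrableOn (ae_of_all _ fun u y _ => ?_)).2
  · refine hd.congr_deriv ?_
    rw [sinTransform, sinTransform, ← integral_sub hi1 hi2]
    refine integral_congr_ae (ae_of_all _ fun u => ?_)
    simp only [sq_mul_one_add_sq_rpow]
    ring
  · rw [norm_neg, norm_mul, norm_eq_abs, norm_eq_abs,
      abs_of_nonneg (by positivity : 0 ≤ u ^ 2 * _)]
    refine (mul_le_of_le_one_left (by positivity) (abs_sin_le_one _)).trans ?_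
    rw [sq_mul_one_add_sq_rpow]
    have : 0 ≤ (1 + u ^ 2) ^ (-s) := by positivity
    linarith
  · have h1 : HasDerivAt (fun y : ℝ => y * u) u y := by simpa using (hasDerivAt_id y).mul_const u
    exact (h1.cos.mul_const _).congr_deriv (by ring)

/-- Integration by parts, as u(1+u²)^(-s) is a multiple of the derivative of (1+u²)^(-(s-1)). -/
lemma cosMoment_eq {s : ℝ} (hs : 3 / 2 < s) (x : ℝ) :
    cosMoment s x = (1 - x * sinTransform (s - 1) x) / (2 * (s - 1)) := by
  have hs1 : 0 < s - 1 := by linarith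
  have hi1 : IntegrableOn (fun u => cos (x * u) * (u * (1 + u ^ 2) ^ (-s))) (Ioi 0) :=
    (integrableOn_id_mul_one_add_sq_rpow (by linarith)).bdd_mul (by fun_prop) (c := 1)
      (ae_of_all _ fun u => abs_cos_le_one _)
  have hi2 := integrableOn_mul_one_add_sq_rpow (s := s - 1) (by linarith)
    (φ := fun u => sin (x * u)) (by fun_prop) fun u => abs_sin_le_one _
  have hder : ∀ u : ℝ, HasDerivAt
      (fun u => -(1 / (2 * (s - 1))) * (cos (x * u) * (1 + u ^ 2) ^ (-(s - 1))))
      (cos (x * u) * (u * (1 + u ^ 2) ^ (-s)) +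
        x / (2 * (s - 1)) * (sin (x * u) * (1 + u ^ 2) ^ (-(s - 1)))) u := by
    intro u
    have h1 : HasDerivAt (fun u : ℝ => x * u) x u := by simpa using (hasDerivAt_id u).const_mul x
    have h2 : HasDerivAt (fun u : ℝ => 1 + u ^ 2) (2 * u) u := by
      simpa using (hasDerivAt_pow 2 u).const_add 1
    have h3 := h2.rpow_const (p := -(s - 1)) (Or.inl (by positivity))
    refine ((h1.cos.mul h3).const_mul (-(1 / (2 * (s - 1))))).congr_deriv ?_
    rw [show -(s - 1) - 1 = -s by ring]
    field_simp
    ring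
  have hlim : Tendsto (fun u => -(1 / (2 * (s - 1))) * (cos (x * u) * (1 + u ^ 2) ^ (-(s - 1))))
      atTop (𝓝 0) := by
    have h0 : Tendsto (fun u : ℝ => (1 + u ^ 2) ^ (-(s - 1))) atTop (𝓝 0) :=
      (tendsto_rpow_neg_atTop hs1).comp
        (tendsto_atTop_add_const_left _ 1 (tendsto_pow_atTop two_ne_zero))
    rw [← mul_zero (-(1 / (2 * (s - 1))))]
    refine Tendsto.const_mul _ (squeeze_zero_norm (fun u => ?_) h0)
    rw [norm_mul, norm_eq_abs, norm_eq_abs, abs_one_add_sq_rpow]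
    exact mul_le_of_le_one_left (by positivity) (abs_cos_le_one _)
  have h := integral_Ioi_of_hasDerivAt_of_tendsto' (fun u _ => hder u)
    (hi1.add (hi2.const_mul _)) hlim
  rw [integral_add hi1 (hi2.const_mul _), integral_const_mul] at h
  simp only [mul_zero, cos_zero, ne_eq, OfNat.ofNat_ne_zero, not_false_eq_true, zero_pow,
    add_zero, one_rpow, mul_one, zero_sub, neg_neg] at h
  rw [cosMoment, sinTransform, sub_div]
  linear_combination h

lemma hasDerivAt_sinTransform_add_one {s : ℝ} (hs : 1 / 2 < s) (x : ℝ) :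
    HasDerivAt (sinTransform (s + 1)) ((1 - x * sinTransform s x) / (2 * s)) x := by
  have h := hasDerivAt_sinTransform (s := s + 1) (by linarith) x
  rwa [cosMoment_eq (by linarith), add_sub_cancel_right] at h

/-- For s ≤ 1 the formally differentiated integrand is not absolutely integrable. Instead x·S_s = 1
- 2s·M_{s+1}, with M the cosine moment, and the right side can be differentiated under the integral.
-/
lemma hasDerivAt_sinTransform_of_pos {s x : ℝ} (hs : 1 / 2 < s) (hx : 0 < x) :
    HasDerivAt (sinTransform s)
      (((2 * s - 1) * sinTransform s x - 2 * s * sinTransform (s + 1) x) / x) x := by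
  have h1 : ∀ y : ℝ, y * sinTransform s y = 1 - 2 * s * cosMoment (s + 1) y := by
    intro y
    rw [cosMoment_eq (by linarith), add_sub_cancel_right, mul_div_cancel₀ _ (by positivity)]
    ring
  have h2 := hasDerivAt_cosMoment (s := s + 1) (by linarith) x
  rw [add_sub_cancel_right] at h2
  have h3 := ((h2.const_mul (2 * s)).const_sub 1).div (hasDerivAt_id x) hx.ne'
  refine (h3.congr_of_eventuallyEq ?_).congr_deriv ?_
  · filter_upwards [eventually_ne_nhds hx.ne'] with y hy
    simp only [Pi.div_apply, id]
    rw [← h1, mul_div_cancel_left₀ _ hy]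
  · rw [← h1]
    simp only [id]
    field_simp
    ring

lemma sinTransform_zero (s : ℝ) : sinTransform s 0 = 0 := by simp [sinTransform]

lemma continuous_sinTransform {s : ℝ} (hs : 1 / 2 < s) : Continuous (sinTransform s) :=
  continuous_of_dominated (bound := fun u => (1 + u ^ 2) ^ (-s))
    (fun x => (continuous_sin.comp (continuous_const_mul x)).mul (continuous_one_add_sq_rpow s)
      |>.aestronglyMeasurable)
    (fun x => ae_of_all _ fun u => by
      rw [norm_mul, norm_eq_abs, norm_eq_abs, abs_one_add_sq_rpow]
      exact mul_le_of_le_one_left (by positivity) (abs_sin_le_one _))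
    (integrable_one_add_sq_rpow hs).integrableOn (ae_of_all _ fun u => by fun_prop)

lemma continuous_cosTransform {s : ℝ} (hs : 1 / 2 < s) : Continuous (cosTransform s) :=
  continuous_of_dominated (bound := fun u => (1 + u ^ 2) ^ (-s))
    (fun x => (continuous_cos.comp (continuous_const_mul x)).mul (continuous_one_add_sq_rpow s)
      |>.aestronglyMeasurable)
    (fun x => ae_of_all _ fun u => by
      rw [norm_mul, norm_eq_abs, norm_eq_abs, abs_one_add_sq_rpow]
      exact mul_le_of_le_one_left (by positivity) (abs_cos_le_one _))
    (integrable_one_add_sq_rpow hs).integrableOn (ae_of_all _ fun u => by fun_prop)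

lemma abs_sinTransform_le {s : ℝ} (hs : 1 / 2 < s) (x : ℝ) :
    |sinTransform s x| ≤ cosTransform s 0 := by
  rw [← norm_eq_abs, cosTransform]
  refine norm_integral_le_of_norm_le
    (integrableOn_mul_one_add_sq_rpow hs (by fun_prop) fun u => abs_cos_le_one _)
    (ae_of_all _ fun u => ?_)
  rw [norm_mul, norm_eq_abs, norm_eq_abs, abs_one_add_sq_rpow,
    zero_mul, cos_zero]
  exact mul_le_mul_of_nonneg_right (abs_sin_le_one _) (by positivity)

/-! ### The exponential integral near 0 and at infinity. -/

/-- The exponential integral `E₁`. -/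
def expIntegralOne (x : ℝ) : ℝ := ∫ s in Ioi x, exp (-s) / s

/-- The continuous extension of `2 sinh s / s`. -/
def twoSinhc : ℝ → ℝ := dslope (fun s => exp s - exp (-s)) 0

/-- The hyperbolic sine integral, times two. -/
def twoShi (x : ℝ) : ℝ := ∫ s in (0 : ℝ)..x, twoSinhc s

lemma integrableOn_exp_neg_div {x : ℝ} (hx : 0 < x) :
    IntegrableOn (fun s => exp (-s) / s) (Ioi x) := by
  refine ((integrableOn_exp_neg_Ioi x).const_mul (1 / x)).mono'
    (Measurable.aestronglyMeasurable (by fun_prop)) ?_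
  filter_upwards [ae_restrict_mem measurableSet_Ioi] with s hs
  have hs : x < s := hs
  have hs0 : 0 < s := hx.trans hs
  rw [norm_eq_abs, abs_of_nonneg (by positivity), div_eq_mul_one_div, mul_comm]
  gcongr

lemma expIntegralOne_nonneg {x : ℝ} (hx : 0 < x) : 0 ≤ expIntegralOne x :=
  setIntegral_nonneg measurableSet_Ioi fun s hs => by
    have : 0 < s := hx.trans hs
    positivity

lemma expIntegralOne_le {x : ℝ} (hx : 0 < x) : expIntegralOne x ≤ exp (-x) / x := by
  have h : expIntegralOne x ≤ ∫ s in Ioi x, 1 / x * exp (-s) := by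
    refine setIntegral_mono_on (integrableOn_exp_neg_div hx)
      ((integrableOn_exp_neg_Ioi x).const_mul (1 / x)) measurableSet_Ioi fun s hs => ?_
    have hs : x < s := hs
    have hs0 : 0 < s := hx.trans hs
    rw [div_eq_mul_one_div, mul_comm]
    gcongr
  rwa [integral_const_mul, integral_exp_neg_Ioi, one_div_mul_eq_div] at h

/-- √x ≤ √s on the domain, so the integral is at most Γ(1/2) = √π. This crude bound replaces the
logarithmic asymptotics at 0. -/
lemma sqrt_mul_expIntegralOne_le {x : ℝ} (hx : 0 < x) : √x * expIntegralOne x ≤ √π := by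
  rw [← Gamma_one_half_eq, Gamma_eq_integral (by norm_num), expIntegralOne, ← integral_const_mul]
  have hG : IntegrableOn (fun s : ℝ => exp (-s) * s ^ ((1 / 2 : ℝ) - 1)) (Ioi 0) :=
    GammaIntegral_convergent (by norm_num)
  refine (setIntegral_mono_on ((integrableOn_exp_neg_div hx).const_mul _)
    (hG.mono_set (Ioi_subset_Ioi hx.le)) measurableSet_Ioi fun s hs => ?_).trans
    (setIntegral_mono_set hG ?_ (Ioi_subset_Ioi hx.le).eventuallyLE)
  · have hs : x < s := hs
    have hs0 : 0 < s := hx.trans hs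
    rw [rpow_sub_one hs0.ne', ← sqrt_eq_rpow, mul_div_assoc', mul_div_assoc', mul_comm]
    gcongr
  · filter_upwards [ae_restrict_mem measurableSet_Ioi] with s hs
    have hs : 0 < s := hs
    positivity

lemma expIntegralOne_eq_add {x y : ℝ} (hx : 0 < x) (hy : 0 < y) :
    expIntegralOne x = (∫ s in x..y, exp (-s) / s) + expIntegralOne y := by
  have := intervalIntegral.integral_Ioi_sub_Ioi' (integrableOn_exp_neg_div hx)
    (integrableOn_exp_neg_div hy)
  rw [expIntegralOne, expIntegralOne, ← this, sub_add_cancel]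

lemma hasDerivAt_expIntegralOne {x : ℝ} (hx : 0 < x) :
    HasDerivAt expIntegralOne (-(exp (-x) / x)) x := by
  have hc : ContinuousOn (fun s : ℝ => exp (-s) / s) (Ioi 0) :=
    ContinuousOn.div (by fun_prop) (by fun_prop) fun s hs => ne_of_gt hs
  have h := intervalIntegral.integral_hasDerivAt_left (a := x) (b := x)
    (f := fun s : ℝ => exp (-s) / s) (by simp)
    (hc.stronglyMeasurableAtFilter isOpen_Ioi x hx) (hc.continuousAt (Ioi_mem_nhds hx))
  refine (h.add_const (expIntegralOne x)).congr_of_eventuallyEq ?_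
  filter_upwards [Ioi_mem_nhds hx] with y hy
  exact expIntegralOne_eq_add hy hx

lemma hasDerivAt_exp_sub_exp_neg (x : ℝ) :
    HasDerivAt (fun s => exp s - exp (-s)) (exp x + exp (-x)) x := by
  have h := (Real.hasDerivAt_exp x).sub (hasDerivAt_neg x).exp
  exact h.congr_deriv (by ring)

lemma continuous_twoSinhc : Continuous twoSinhc := by
  rw [← continuousOn_univ, twoSinhc, continuousOn_dslope univ_mem]
  exact ⟨by fun_prop, (hasDerivAt_exp_sub_exp_neg 0).differentiableAt⟩

lemma twoSinhc_of_ne {s : ℝ} (hs : s ≠ 0) : twoSinhc s = exp s / s - exp (-s) / s := by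
  rw [twoSinhc, dslope_of_ne _ hs, slope_def_field]
  simp
  ring

lemma hasDerivAt_twoShi (x : ℝ) : HasDerivAt twoShi (twoSinhc x) x :=
  continuous_twoSinhc.integral_hasStrictDerivAt 0 x |>.hasDerivAt

lemma twoShi_zero : twoShi 0 = 0 := by simp [twoShi]

lemma exp_sub_exp_neg_le {s : ℝ} : exp s - exp (-s) ≤ 2 * s * exp s := by
  have h := add_one_le_exp (-(2 * s))
  have h2 : exp (-s) = exp (-(2 * s)) * exp s := by rw [← exp_add]; ring_nf
  rw [h2]
  nlinarith [exp_pos s]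

lemma abs_twoShi_le {x : ℝ} (hx : 0 ≤ x) : |twoShi x| ≤ 2 * exp x := by
  have hnn : ∀ s : ℝ, 0 < s → 0 ≤ twoSinhc s ∧ twoSinhc s ≤ 2 * exp s := by
    intro s hs
    rw [twoSinhc_of_ne hs.ne', ← sub_div, le_div_iff₀ hs, div_le_iff₀ hs, zero_mul]
    refine ⟨?_, by linarith [exp_sub_exp_neg_le (s := s)]⟩
    have : exp (-s) ≤ exp s := exp_le_exp.2 (by linarith)
    linarith
  have h1 : 0 ≤ twoShi x := by
    rw [twoShi, intervalIntegral.integral_of_le hx]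
    exact setIntegral_nonneg measurableSet_Ioc fun s hs => (hnn s hs.1).1
  have h2 : twoShi x ≤ ∫ s in (0 : ℝ)..x, 2 * exp s := by
    refine intervalIntegral.integral_mono_on_of_le_Ioo hx
      (continuous_twoSinhc.intervalIntegrable _ _)
      (Continuous.intervalIntegrable (by fun_prop) _ _) fun s hs => (hnn s hs.1).2
  rw [intervalIntegral.integral_const_mul, integral_exp, exp_zero] at h2
  rw [abs_of_nonneg h1]
  linarith

lemma setIntegral_exp_div_Iic {x : ℝ} :
    ∫ s in Iic (-x), exp s / s = -expIntegralOne x := by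
  have h := integral_comp_neg_Iic (-x) (fun s => exp (-s) / s)
  rw [neg_neg] at h
  rw [expIntegralOne, ← h, ← integral_neg]
  refine integral_congr_ae (ae_of_all _ fun s => ?_)
  simp only [neg_neg]
  rw [div_neg, neg_neg]

lemma integrableOn_exp_div_Iic {x : ℝ} (hx : 0 < x) :
    IntegrableOn (fun s => exp s / s) (Iic (-x)) := by
  have h := Iff.mpr integrableOn_Ici_iff_integrableOn_Ioi (integrableOn_exp_neg_div hx)
  rw [← neg_neg x] at h
  refine (h.comp_neg_Iic).neg.congr_fun (fun s _ => ?_) measurableSet_Iic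
  simp only [Pi.neg_apply, neg_neg]
  rw [div_neg, neg_neg]

/-- Once ε < x the excised window misses the domain, so the limit is of an eventually constant
function. -/
lemma expInt_neg {x : ℝ} (hx : 0 < x) : expInt (-x) = -expIntegralOne x := by
  refine Tendsto.limUnder_eq (tendsto_const_nhds.congr' ?_)
  filter_upwards [Ioo_mem_nhdsGT hx] with ε hε
  rw [← setIntegral_exp_div_Iic]
  congr 2
  rw [eq_comm, sdiff_eq_left, Set.disjoint_left]
  intro s hs hs'
  have hs : s ≤ -x := hs
  linarith [hs'.1, hε.2]

/-- Folding the negative half onto the positive one pairs e^s/s with -e^(-s)/s; the 1/s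
singularities cancel and the limit ε → 0 becomes continuity of `twoShi`. -/
lemma expInt_pos {x : ℝ} (hx : 0 < x) : expInt x = twoShi x - expIntegralOne x := by
  refine Tendsto.limUnder_eq ?_
  have hlim : Tendsto (fun ε => twoShi x - twoShi ε - expIntegralOne x) (𝓝[>] 0)
      (𝓝 (twoShi x - expIntegralOne x)) := by
    have h : Tendsto twoShi (𝓝[>] 0) (𝓝 (twoShi 0)) :=
      (hasDerivAt_twoShi 0).continuousAt.tendsto.mono_left nhdsWithin_le_nhds
    simpa [twoShi_zero] using ((h.const_sub (twoShi x)).sub_const (expIntegralOne x))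
  refine hlim.congr' ?_
  filter_upwards [Ioo_mem_nhdsGT hx] with ε hε
  have hset : Iic x \ Ioo (-ε) ε = Iic (-ε) ∪ Icc ε x := by
    ext s
    simp only [Set.mem_sdiff, mem_Iic, mem_Ioo, mem_union, mem_Icc, not_and, not_lt]
    constructor
    · rintro ⟨h1, h2⟩
      rcases le_or_gt s (-ε) with h | h
      · exact Or.inl h
      · exact Or.inr ⟨h2 h, h1⟩
    · rintro (h | h)
      · exact ⟨by linarith [hε.1, hε.2], fun h' => by linarith⟩
      · exact ⟨h.2, fun _ => h.1⟩
  have hdisj : Disjoint (Iic (-ε)) (Icc ε x) := by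
    rw [Set.disjoint_left]
    intro s hs hs'
    have hs : s ≤ -ε := hs
    linarith [hs'.1, hε.1]
  have hIcc : ∀ s ∈ uIcc ε x, s ≠ 0 := fun s hs => by
    replace hs : s ∈ Icc ε x := by rwa [uIcc_of_le hε.2.le] at hs
    exact ne_of_gt (hε.1.trans_le hs.1)
  have hc1 : ContinuousOn (fun s => exp s / s) (uIcc ε x) :=
    ContinuousOn.div (by fun_prop) (by fun_prop) hIcc
  have hc2 : ContinuousOn (fun s => exp (-s) / s) (uIcc ε x) :=
    ContinuousOn.div (by fun_prop) (by fun_prop) hIcc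
  rw [hset, setIntegral_union hdisj measurableSet_Icc (integrableOn_exp_div_Iic hε.1)
    (by rw [← uIcc_of_le hε.2.le]; exact hc1.integrableOn_compact isCompact_uIcc),
    setIntegral_exp_div_Iic, expIntegralOne_eq_add hε.1 hx, integral_Icc_eq_integral_Ioc,
    ← intervalIntegral.integral_of_le hε.2.le]
  have h1 : twoShi x - twoShi ε = ∫ s in ε..x, twoSinhc s :=
    intervalIntegral.integral_interval_sub_left (continuous_twoSinhc.intervalIntegrable _ _)
      (continuous_twoSinhc.intervalIntegrable _ _)
  have h2 : ∫ s in ε..x, twoSinhc s = (∫ s in ε..x, exp s / s) - ∫ s in ε..x, exp (-s) / s := by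
    rw [← intervalIntegral.integral_sub hc1.intervalIntegrable hc2.intervalIntegrable]
    exact intervalIntegral.integral_congr fun s hs => twoSinhc_of_ne (hIcc s hs)
  rw [h1, h2]
  ring

/-- The function `e^(-x) Ei(x)`. -/
def scaledExpInt (x : ℝ) : ℝ := exp (-x) * expInt x

lemma hasDerivAt_scaledExpInt {x : ℝ} (hx : x ≠ 0) :
    HasDerivAt scaledExpInt (-scaledExpInt x + 1 / x) x := by
  suffices h : HasDerivAt expInt (exp x / x) x by
    refine ((hasDerivAt_neg x).exp.mul h).congr_deriv ?_
    have : exp (-x) * exp x = 1 := by rw [← exp_add]; simp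
    rw [scaledExpInt]
    linear_combination (1 / x) * this
  rcases hx.lt_or_gt with hx | hx
  · have hx' : 0 < -x := by linarith
    have h := ((hasDerivAt_expIntegralOne hx').comp x (hasDerivAt_neg x)).neg
    refine (h.congr_of_eventuallyEq ?_).congr_deriv ?_
    · filter_upwards [Iio_mem_nhds hx] with y hy
      have hy : y < 0 := hy
      have := expInt_neg (x := -y) (by linarith)
      rw [neg_neg] at this
      simpa using this
    · rw [neg_neg, div_neg]
      ring
  · refine (((hasDerivAt_twoShi x).sub (hasDerivAt_expIntegralOne hx)).congr_of_eventuallyEq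
      ?_).congr_deriv ?_
    · filter_upwards [Ioi_mem_nhds hx] with y hy
      exact expInt_pos hy
    · rw [twoSinhc_of_ne hx.ne']
      ring

lemma tendsto_mul_expIntegralOne : Tendsto (fun x => x * expIntegralOne x) (𝓝[>] 0) (𝓝 0) := by
  have h0 : Tendsto (fun x : ℝ => √x * √π) (𝓝[>] 0) (𝓝 0) := by
    have : Tendsto (fun x : ℝ => √x * √π) (𝓝 0) (𝓝 (√0 * √π)) :=
      (by fun_prop : Continuous fun x : ℝ => √x * √π).tendsto 0
    simpa using this.mono_left nhdsWithin_le_nhds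
  refine squeeze_zero' ?_ ?_ h0
  · filter_upwards [self_mem_nhdsWithin] with x hx
    have hx : 0 < x := hx
    exact mul_nonneg hx.le (expIntegralOne_nonneg hx)
  · filter_upwards [self_mem_nhdsWithin] with x hx
    have hx : 0 < x := hx
    calc x * expIntegralOne x = √x * (√x * expIntegralOne x) := by
          rw [← mul_assoc, mul_self_sqrt hx.le]
      _ ≤ √x * √π := by gcongr; exact sqrt_mul_expIntegralOne_le hx

/-- The difference is e^(-x)·`twoShi` plus (e^x - e^(-x))E₁(x); the second part is `twoSinhc` times
xE₁(x), which tends to 0. -/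
lemma tendsto_scaledExpInt_sub :
    Tendsto (fun x => scaledExpInt x - scaledExpInt (-x)) (𝓝[>] 0) (𝓝 0) := by
  have h1 : Tendsto (fun x => exp (-x) * twoShi x) (𝓝[>] 0) (𝓝 0) := by
    have : ContinuousAt (fun x => exp (-x) * twoShi x) 0 :=
      ContinuousAt.mul (by fun_prop) (hasDerivAt_twoShi 0).continuousAt
    simpa [ContinuousAt, twoShi_zero] using this.tendsto.mono_left (nhdsWithin_le_nhds (s := Ioi 0))
  have h2 : Tendsto (fun x => twoSinhc x * (x * expIntegralOne x)) (𝓝[>] 0) (𝓝 0) := by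
    simpa using ((continuous_twoSinhc.tendsto 0).mono_left nhdsWithin_le_nhds).mul
      tendsto_mul_expIntegralOne
  have h := h1.add h2
  rw [add_zero] at h
  refine h.congr' ?_
  filter_upwards [self_mem_nhdsWithin] with x hx
  have hx : 0 < x := hx
  rw [scaledExpInt, scaledExpInt, expInt_neg hx, expInt_pos hx, twoSinhc_of_ne hx.ne', neg_neg]
  field_simp
  ring

lemma tendsto_mul_scaledExpInt_add :
    Tendsto (fun x => x * (scaledExpInt x + scaledExpInt (-x))) (𝓝[>] 0) (𝓝 0) := by
  have h1 : Tendsto (fun x => x * (exp (-x) * twoShi x)) (𝓝[>] 0) (𝓝 0) := by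
    have : ContinuousAt (fun x => x * (exp (-x) * twoShi x)) 0 :=
      continuousAt_id.mul (ContinuousAt.mul (by fun_prop) (hasDerivAt_twoShi 0).continuousAt)
    simpa [ContinuousAt, twoShi_zero] using this.tendsto.mono_left (nhdsWithin_le_nhds (s := Ioi 0))
  have h2 : Tendsto (fun x => (exp x + exp (-x)) * (x * expIntegralOne x)) (𝓝[>] 0) (𝓝 0) := by
    have h3 : Tendsto (fun x : ℝ => exp x + exp (-x)) (𝓝 0) (𝓝 (exp 0 + exp (-0))) :=
      (by fun_prop : Continuous fun x : ℝ => exp x + exp (-x)).tendsto 0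
    simpa using (h3.mono_left nhdsWithin_le_nhds).mul tendsto_mul_expIntegralOne
  have h := h1.sub h2
  rw [sub_zero] at h
  refine h.congr' ?_
  filter_upwards [self_mem_nhdsWithin] with x hx
  have hx : 0 < x := hx
  rw [scaledExpInt, scaledExpInt, expInt_neg hx, expInt_pos hx, neg_neg]
  ring

lemma abs_scaledExpInt_sub_le {x : ℝ} (hx : 1 ≤ x) :
    |scaledExpInt x - scaledExpInt (-x)| ≤ 4 := by
  have hx0 : 0 < x := by linarith
  have h1 := expIntegralOne_nonneg hx0
  have h2 : exp x * expIntegralOne x ≤ 1 := by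
    have h3 : expIntegralOne x ≤ exp (-x) := (expIntegralOne_le hx0).trans
      (div_le_self (exp_pos _).le hx)
    calc _ ≤ exp x * exp (-x) := by gcongr
      _ = 1 := by rw [← exp_add]; simp
  have h4 : exp (-x) * expIntegralOne x ≤ exp x * expIntegralOne x := by
    gcongr
    linarith
  have h5 : |exp (-x) * twoShi x| ≤ 2 := by
    rw [abs_mul, abs_exp]
    calc _ ≤ exp (-x) * (2 * exp x) := by gcongr; exact abs_twoShi_le hx0.le
      _ = 2 * exp (-x + x) := by rw [exp_add]; ring
      _ = 2 := by simp
  have h6 : 0 ≤ exp (-x) * expIntegralOne x := by positivity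
  rw [scaledExpInt, scaledExpInt, expInt_neg hx0, expInt_pos hx0, neg_neg, abs_le]
  rw [abs_le] at h5
  constructor <;> nlinarith

/-! ### The finite sum of the odd case and its recurrence. -/

/-- The functions `x^n e^(-x) Ei(x) - ∑_{j=1}^n (j-1)! x^(n-j)`. -/
def expIntRemainder : ℕ → ℝ → ℝ
  | 0, x => scaledExpInt x
  | n + 1, x => x * expIntRemainder n x - n.factorial

lemma expIntRemainder_succ (n : ℕ) (x : ℝ) :
    expIntRemainder (n + 1) x = x * expIntRemainder n x - n.factorial := rfl

lemma hasDerivAt_expIntRemainder_succ (n : ℕ) {x : ℝ} (hx : x ≠ 0) :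
    HasDerivAt (expIntRemainder (n + 1))
      ((n + 1) * expIntRemainder n x - expIntRemainder (n + 1) x) x := by
  induction n with
  | zero =>
    refine (((hasDerivAt_id x).mul (hasDerivAt_scaledExpInt hx)).sub_const 1).congr_deriv ?_
      |>.congr_of_eventuallyEq (Eventually.of_forall fun y => ?_)
    · simp only [expIntRemainder, id]
      field_simp
      simp
      ring
    · simp [expIntRemainder]
  | succ n ih =>
    refine (((hasDerivAt_id x).mul ih).sub_const ((n + 1).factorial : ℝ)).congr_deriv ?_
    simp only [expIntRemainder_succ, Nat.factorial_succ, id]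
    push_cast
    ring

lemma expIntRemainder_eq (n : ℕ) (x : ℝ) :
    expIntRemainder n x = x ^ n * scaledExpInt x -
      ∑ j ∈ Finset.Icc 1 n, ((j - 1).factorial : ℝ) * x ^ (n - j) := by
  induction n with
  | zero => simp [expIntRemainder]
  | succ n ih =>
    rw [expIntRemainder_succ, ih, Finset.sum_Icc_succ_top (by omega)]
    have : ∑ j ∈ Finset.Icc 1 n, ((j - 1).factorial : ℝ) * x ^ (n + 1 - j) =
        x * ∑ j ∈ Finset.Icc 1 n, ((j - 1).factorial : ℝ) * x ^ (n - j) := by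
      rw [Finset.mul_sum]
      refine Finset.sum_congr rfl fun j hj => ?_
      rw [Nat.sub_add_comm (Finset.mem_Icc.1 hj).2, pow_succ]
      ring
    rw [this]
    simp
    ring

/-- The coefficients of the odd sum. -/
def oddCoeff (m n : ℕ) : ℝ :=
  (Nat.choose (2 * m - n) m : ℝ) * ((2 : ℝ) ^ ((n : ℤ) - 2 * (m : ℤ) - 1) / (n.factorial : ℝ))

/-- With k = n + 1, the factor 1 + (-1)^(k+j) records the difference between the polynomial parts at
x and at -x. -/
lemma oddSum_eq (m : ℕ) (x : ℝ) :
    oddSum m x = ∑ n ∈ Finset.range (m + 1),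
      oddCoeff m n * (expIntRemainder n x - expIntRemainder n (-x)) := by
  rw [oddSum, ← Finset.Ico_add_one_right_eq_Icc, Finset.sum_Ico_eq_sum_range]
  refine Finset.sum_congr (by simp) fun n _ => ?_
  rw [oddCoeff, expIntRemainder_eq, expIntRemainder_eq, show 2 * m + 1 - (1 + n) = 2 * m - n by omega,
    show 1 + n - 1 = n by omega, show ((1 + n : ℕ) : ℤ) - 2 * m - 2 = n - 2 * m - 1 by push_cast; ring]
  congr 1
  have h : ∑ j ∈ Finset.Icc 1 n, ((j - 1).factorial : ℝ) * (1 + (-1 : ℝ) ^ (1 + n + j)) *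
      x ^ (1 + n - j - 1) = (∑ j ∈ Finset.Icc 1 n, ((j - 1).factorial : ℝ) * x ^ (n - j)) -
        ∑ j ∈ Finset.Icc 1 n, ((j - 1).factorial : ℝ) * (-x) ^ (n - j) := by
    rw [← Finset.sum_sub_distrib]
    refine Finset.sum_congr rfl fun j hj => ?_
    have hj := (Finset.mem_Icc.1 hj).2
    rw [show 1 + n - j - 1 = n - j by omega, neg_pow x,
      show 1 + n + j = 1 + (n - j) + 2 * j by omega, pow_add, pow_add, pow_mul]
    simp
    ring
  rw [h, scaledExpInt, scaledExpInt, neg_neg, neg_pow x n, pow_add]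
  ring

/-- Pascal's rule writes the sum for m+1 as the sum for m plus half of itself; the two boundary
terms cancel because C(2m+2, m+1) = 2C(2m+1, m). -/
lemma sum_choose_div_two_pow (m : ℕ) :
    ∑ i ∈ Finset.range (m + 1), (Nat.choose (m + i) m : ℝ) / 2 ^ i = 2 ^ m := by
  induction m with
  | zero => simp
  | succ m ih =>
    have h1 : ∑ i ∈ Finset.range (m + 1 + 1), (Nat.choose (m + 1 + i) (m + 1) : ℝ) / 2 ^ i =
        ∑ i ∈ Finset.range (m + 1 + 1), (Nat.choose (m + i) m : ℝ) / 2 ^ i +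
        ∑ i ∈ Finset.range (m + 1 + 1), (Nat.choose (m + i) (m + 1) : ℝ) / 2 ^ i := by
      rw [← Finset.sum_add_distrib]
      refine Finset.sum_congr rfl fun i _ => ?_
      rw [show m + 1 + i = m + i + 1 by ring, Nat.choose_succ_succ]
      push_cast
      ring
    have h2 : ∑ i ∈ Finset.range (m + 1 + 1), (Nat.choose (m + i) (m + 1) : ℝ) / 2 ^ i =
        1 / 2 * ∑ i ∈ Finset.range (m + 1), (Nat.choose (m + 1 + i) (m + 1) : ℝ) / 2 ^ i := by
      rw [Finset.sum_range_succ', Finset.mul_sum]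
      simp only [add_zero, Nat.choose_succ_self, Nat.cast_zero, zero_div]
      refine Finset.sum_congr rfl fun i _ => ?_
      rw [show m + (i + 1) = m + 1 + i by ring, pow_succ]
      ring
    have h3 : ((m + 1 + (m + 1)).choose (m + 1) : ℝ) = 2 * ((m + (m + 1)).choose m : ℝ) := by
      rw [show m + 1 + (m + 1) = m + (m + 1) + 1 by ring, Nat.choose_succ_succ,
        ← Nat.choose_symm_of_eq_add (show m + (m + 1) = m + (m + 1) from rfl)]
      push_cast
      ring
    rw [Finset.sum_range_succ] at h1
    rw [Finset.sum_range_succ (n := m + 1), ih, h2] at h1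
    rw [Finset.sum_range_succ, pow_succ 2 m]
    rw [h3] at h1 ⊢
    linear_combination 2 * h1

/-- Supplies the constant 1 in the recurrence of `hasDerivAt_oddSum_succ`. -/
lemma sum_oddCoeff_mul_factorial (m : ℕ) :
    ∑ n ∈ Finset.range (m + 1), oddCoeff m n * n.factorial = 1 / 2 := by
  rw [← Finset.sum_range_reflect]
  have h := congrArg (fun y : ℝ => y * (1 / 2) / 2 ^ m) (sum_choose_div_two_pow m)
  simp only [Finset.sum_mul, Finset.sum_div] at h
  rw [show (2 : ℝ) ^ m * (1 / 2) / 2 ^ m = 1 / 2 by field_simp] at h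
  rw [← h]
  refine Finset.sum_congr rfl fun i hi => ?_
  have hi : i ≤ m := by simpa [Nat.lt_succ_iff] using hi
  rw [show m + 1 - 1 - i = m - i by omega, oddCoeff, show 2 * m - (m - i) = m + i by omega,
    show ((m - i : ℕ) : ℤ) - 2 * m - 1 = -((m + i + 1 : ℕ) : ℤ) by omega, zpow_neg, zpow_natCast]
  have : ((m - i).factorial : ℝ) ≠ 0 := by positivity
  field_simp
  ring

lemma oddCoeff_zero (m : ℕ) : oddCoeff (m + 1) 1 = oddCoeff (m + 1) 0 := by
  rw [oddCoeff, oddCoeff, show 2 * (m + 1) - 1 = m + (m + 1) by omega,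
    show 2 * (m + 1) - 0 = m + (m + 1) + 1 by omega, Nat.choose_succ_succ,
    Nat.choose_symm_of_eq_add (show m + (m + 1) = m + (m + 1) from rfl),
    show ((1 : ℕ) : ℤ) - 2 * (m + 1 : ℕ) - 1 = ((0 : ℕ) : ℤ) - 2 * (m + 1 : ℕ) - 1 + 1 by
      push_cast; ring, zpow_add_one₀ two_ne_zero]
  push_cast
  simp
  ring

/-- The coefficient identity that turns the derivative of the sum for m+1 into the sum for m. -/
lemma oddCoeff_succ (m n : ℕ) (hn : n ≤ m) :
    (n + 2) * oddCoeff (m + 1) (n + 2) - oddCoeff (m + 1) (n + 1) =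
      -(oddCoeff m n / (2 * (m + 1))) := by
  have h1 : ((2 * m - n).choose (m + 1) : ℝ) * (m + 1) = (2 * m - n).choose m * (m - n) := by
    have := Nat.choose_succ_right_eq (2 * m - n) m
    rw [show 2 * m - n - m = m - n by omega] at this
    rw [← Nat.cast_sub hn]
    exact_mod_cast this
  have h2 : ((2 * m - n + 1).choose (m + 1) : ℝ) =
      (2 * m - n).choose m + (2 * m - n).choose (m + 1) := by
    rw [Nat.choose_succ_succ]
    push_cast
    ring
  rw [oddCoeff, oddCoeff, oddCoeff, show 2 * (m + 1) - (n + 2) = 2 * m - n by omega,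
    show 2 * (m + 1) - (n + 1) = 2 * m - n + 1 by omega, h2,
    show ((n + 2 : ℕ) : ℤ) - 2 * (m + 1 : ℕ) - 1 = (n : ℤ) - 2 * m - 1 by push_cast; ring,
    show ((n + 1 : ℕ) : ℤ) - 2 * (m + 1 : ℕ) - 1 = (n : ℤ) - 2 * m - 1 - 1 by push_cast; ring,
    zpow_sub_one₀ two_ne_zero ((n : ℤ) - 2 * m - 1), Nat.factorial_succ, Nat.factorial_succ]
  push_cast
  have h3 : (m : ℝ) + 1 ≠ 0 := by positivity
  have h4 : ((2 * m - n).choose (m + 1) : ℝ) = (2 * m - n).choose m * (m - n) / (m + 1) := by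
    rw [eq_div_iff h3, h1]
  rw [h4]
  have : (n.factorial : ℝ) ≠ 0 := by positivity
  generalize (2 : ℝ) ^ ((n : ℤ) - 2 * m - 1) = w
  field_simp
  ring

lemma hasDerivAt_comp_neg_of_hasDerivAt {f : ℝ → ℝ} {f' x : ℝ} (h : HasDerivAt f f' (-x)) :
    HasDerivAt (fun y => f (-y)) (-f') x :=
  (h.comp x (hasDerivAt_neg x)).congr_deriv (by ring)

lemma eq_of_hasDerivAt_zero_Ioi {f : ℝ → ℝ} (hf : ∀ x, 0 < x → HasDerivAt f 0 x) {x y : ℝ}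
    (hx : 0 < x) (hy : 0 < y) : f x = f y :=
  (convex_Ioi (0 : ℝ)).is_const_of_fderivWithin_eq_zero (𝕜 := ℝ)
    (fun z hz => (hf z hz).differentiableAt.differentiableWithinAt)
    (fun z hz => by
      rw [fderivWithin_of_isOpen isOpen_Ioi hz]
      ext
      simp [(hf z hz).deriv]) hx hy

/-- The recurrence of `hasDerivAt_sinTransform_add_one` at s = m+1. Differentiation turns the
differences at ±x into the sums Z; after regrouping, the Z 0 terms cancel by `oddCoeff_zero`, and
each Z (n+1) is x times a difference minus 2·n!. -/
lemma hasDerivAt_oddSum_succ (m : ℕ) {x : ℝ} (hx : 0 < x) :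
    HasDerivAt (oddSum (m + 1)) ((1 - x * oddSum m x) / (2 * (m + 1))) x := by
  set Z : ℕ → ℝ := fun n => expIntRemainder n x + expIntRemainder n (-x) with hZ
  have h0 : HasDerivAt (fun y => expIntRemainder 0 y - expIntRemainder 0 (-y)) (-Z 0) x := by
    have h1 : HasDerivAt (expIntRemainder 0) _ x := hasDerivAt_scaledExpInt hx.ne'
    have h2 : HasDerivAt (expIntRemainder 0) _ (-x) := hasDerivAt_scaledExpInt (neg_ne_zero.2 hx.ne')
    refine (h1.sub (hasDerivAt_comp_neg_of_hasDerivAt h2)).congr_deriv ?_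
    simp only [hZ, expIntRemainder]
    rw [div_neg]
    ring
  have hs : ∀ n : ℕ, HasDerivAt (fun y => expIntRemainder (n + 1) y - expIntRemainder (n + 1) (-y))
      ((n + 1) * Z n - Z (n + 1)) x := fun n => by
    refine ((hasDerivAt_expIntRemainder_succ n hx.ne').sub
      (hasDerivAt_comp_neg_of_hasDerivAt (hasDerivAt_expIntRemainder_succ n (neg_ne_zero.2 hx.ne')))).congr_deriv ?_
    simp only [hZ]
    ring
  have hZs : ∀ n : ℕ, Z (n + 1) =
      x * (expIntRemainder n x - expIntRemainder n (-x)) - 2 * n.factorial := fun n => by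
    simp only [hZ, expIntRemainder_succ]
    ring
  have hfun : oddSum (m + 1) = fun y => ∑ n ∈ Finset.range (m + 1 + 1), oddCoeff (m + 1) (n + 1) *
        (expIntRemainder (n + 1) y - expIntRemainder (n + 1) (-y)) +
      oddCoeff (m + 1) 0 * (expIntRemainder 0 y - expIntRemainder 0 (-y)) := by
    ext y
    -- The range is extended by one term whose binomial coefficient is zero, so that the regrouping
    -- leaves no boundary term at the top.
    have hlast : oddCoeff (m + 1) (m + 1 + 1) = 0 := by
      rw [oddCoeff, Nat.choose_eq_zero_of_lt (by omega)]
      simp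
    rw [oddSum_eq, Finset.sum_range_succ', Finset.sum_range_succ (n := m + 1), hlast, zero_mul,
      add_zero]
  rw [hfun]
  refine ((HasDerivAt.fun_sum fun n _ => (hs n).const_mul _).add (h0.const_mul _)).congr_deriv ?_
  have hsplit : ∑ n ∈ Finset.range (m + 1 + 1), oddCoeff (m + 1) (n + 1) *
      ((n + 1) * Z n - Z (n + 1)) = oddCoeff (m + 1) 1 * Z 0 +
      ∑ n ∈ Finset.range (m + 1), ((n + 2) * oddCoeff (m + 1) (n + 2) -
        oddCoeff (m + 1) (n + 1)) * Z (n + 1) := by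
    have hlast : oddCoeff (m + 1) (m + 1 + 1) = 0 := by
      rw [oddCoeff, Nat.choose_eq_zero_of_lt (by omega)]
      simp
    simp only [mul_sub, sub_mul, Finset.sum_sub_distrib]
    rw [Finset.sum_range_succ', Finset.sum_range_succ _ (m + 1), hlast, zero_mul, add_zero]
    have : ∑ n ∈ Finset.range (m + 1), oddCoeff (m + 1) (n + 1 + 1) *
        (((n + 1 : ℕ) + 1 : ℝ) * Z (n + 1)) =
        ∑ n ∈ Finset.range (m + 1), (n + 2) * oddCoeff (m + 1) (n + 2) * Z (n + 1) :=
      Finset.sum_congr rfl fun n _ => by push_cast; ring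
    rw [this]
    push_cast
    ring
  have hsum : ∑ n ∈ Finset.range (m + 1), ((n + 2) * oddCoeff (m + 1) (n + 2) -
      oddCoeff (m + 1) (n + 1)) * Z (n + 1) = -(1 / (2 * (m + 1))) *
      (x * oddSum m x - 2 * ∑ n ∈ Finset.range (m + 1), oddCoeff m n * n.factorial) := by
    rw [oddSum_eq, Finset.mul_sum, Finset.mul_sum, ← Finset.sum_sub_distrib, Finset.mul_sum]
    refine Finset.sum_congr rfl fun n hn => ?_
    rw [oddCoeff_succ m n (Nat.lt_succ_iff.1 (Finset.mem_range.1 hn)), hZs]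
    ring
  rw [hsplit, hsum, sum_oddCoeff_mul_factorial, oddCoeff_zero]
  ring

/-- The two limits need a joint induction: the difference at n+1 is x times the sum at n, and the
sum at n+1 is x times the difference at n minus a constant. -/
lemma tendsto_expIntRemainder (n : ℕ) :
    Tendsto (fun x => expIntRemainder n x - expIntRemainder n (-x)) (𝓝[>] 0) (𝓝 0) ∧
      Tendsto (fun x => x * (expIntRemainder n x + expIntRemainder n (-x))) (𝓝[>] 0) (𝓝 0) := by
  have hid : Tendsto (fun x : ℝ => x) (𝓝[>] 0) (𝓝 0) := tendsto_id.mono_left nhdsWithin_le_nhds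
  induction n with
  | zero => exact ⟨tendsto_scaledExpInt_sub, tendsto_mul_scaledExpInt_add⟩
  | succ n ih =>
    refine ⟨ih.2.congr fun x => ?_, ?_⟩
    · simp only [expIntRemainder_succ]
      ring
    · have h := (hid.mul (hid.mul ih.1)).sub (hid.mul_const (2 * n.factorial : ℝ))
      simp only [zero_mul, mul_zero, sub_zero] at h
      refine h.congr fun x => ?_
      simp only [expIntRemainder_succ]
      ring

lemma tendsto_oddSum (m : ℕ) : Tendsto (oddSum m) (𝓝[>] 0) (𝓝 0) := by
  have h := tendsto_finsetSum (Finset.range (m + 1)) fun n _ =>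
    (tendsto_expIntRemainder n).1.const_mul (oddCoeff m n)
  simp only [mul_zero, Finset.sum_const_zero] at h
  exact h.congr fun x => (oddSum_eq m x).symm

lemma oddSum_zero (x : ℝ) : oddSum 0 x = (scaledExpInt x - scaledExpInt (-x)) / 2 := by
  rw [oddSum_eq]
  simp [oddCoeff, expIntRemainder]
  ring

/-! ### The sine transform when ν is an odd integer. -/

/-- A bounded solution of `D'' = D` on the half-line that vanishes at the origin is zero. -/
lemma eq_zero_of_second_deriv_eq_self {D D' : ℝ → ℝ} (h1 : ∀ x, 0 < x → HasDerivAt D (D' x) x)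
    (h2 : ∀ x, 0 < x → HasDerivAt D' (D x) x) (h0 : Tendsto D (𝓝[>] 0) (𝓝 0)) {B : ℝ}
    (hB : ∀ x, 1 ≤ x → |D x| ≤ B) {x : ℝ} (hx : 0 < x) : D x = 0 := by
  -- The first integrals e^(-x)(D + D') and e^x(D - D') are constant, so D = (a e^x + b e^(-x))/2;
  -- boundedness forces a = 0 and the limit at 0 forces a + b = 0.
  have ha := fun x hx => eq_of_hasDerivAt_zero_Ioi (y := 1) (f := fun x => exp (-x) * (D x + D' x)) (fun x hx =>
    ((hasDerivAt_neg x).exp.mul ((h1 x hx).add (h2 x hx))).congr_deriv (by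
      simp only [Pi.add_apply]; ring)) (x := x) hx one_pos
  have hb := fun x hx => eq_of_hasDerivAt_zero_Ioi (y := 1) (f := fun x => exp x * (D x - D' x)) (fun x hx =>
    ((Real.hasDerivAt_exp x).mul ((h1 x hx).sub (h2 x hx))).congr_deriv (by
      simp only [Pi.sub_apply]; ring)) (x := x) hx one_pos
  set a := exp (-1) * (D 1 + D' 1)
  set b := exp 1 * (D 1 - D' 1)
  have hsol : ∀ x, 0 < x → D x = (a * exp x + b * exp (-x)) / 2 := by
    intro x hx
    rw [← ha x hx, ← hb x hx]
    have : exp (-x) * exp x = 1 := by rw [← exp_add]; simp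
    linear_combination (-D x) * this
  have hab : a + b = 0 := by
    have hc : Tendsto (fun x => (a * exp x + b * exp (-x)) / 2) (𝓝[>] 0)
        (𝓝 ((a * exp 0 + b * exp (-0)) / 2)) :=
      ((by fun_prop : Continuous fun x => (a * exp x + b * exp (-x)) / 2).tendsto 0).mono_left
        nhdsWithin_le_nhds
    have hev : ∀ᶠ x in 𝓝[>] (0 : ℝ), D x = (a * exp x + b * exp (-x)) / 2 :=
      eventually_mem_nhdsWithin.mono fun x hx => hsol x hx
    have hc' := tendsto_nhds_unique (h0.congr' hev) hc
    simp at hc'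
    linarith
  have ha0 : a = 0 := by
    have hlim : Tendsto (fun x => exp (-x) * D x) atTop (𝓝 0) := by
      have h3 : Tendsto (fun x : ℝ => exp (-x) * B) atTop (𝓝 0) := by
        simpa using tendsto_exp_neg_atTop_nhds_zero.mul_const B
      refine squeeze_zero_norm' ?_ h3
      filter_upwards [eventually_ge_atTop 1] with x hx
      rw [norm_mul, norm_eq_abs, norm_eq_abs, abs_exp]
      gcongr
      exact hB x hx
    have hlim2 : Tendsto (fun x => (a + b * (exp (-x) * exp (-x))) / 2) atTop (𝓝 (a / 2)) := by
      have h4 := tendsto_exp_neg_atTop_nhds_zero.mul tendsto_exp_neg_atTop_nhds_zero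
      simpa using ((h4.const_mul b).const_add a).div_const 2
    have := tendsto_nhds_unique (hlim.congr' ?_) hlim2
    · linarith
    · filter_upwards [eventually_gt_atTop 0] with x hx
      rw [hsol x hx]
      have : exp (-x) * exp x = 1 := by rw [← exp_add]; simp
      linear_combination (a / 2) * this
  have hb0 : b = 0 := by linarith
  rw [hsol x hx, ha0, hb0]
  simp

/-- Both sides solve S'' = S - 1/x, tend to 0 at the origin and are bounded on [1, ∞), so their
difference vanishes. -/
lemma sinTransform_one {x : ℝ} (hx : 0 < x) : sinTransform 1 x = oddSum 0 x := by
  have hs : (1 : ℝ) / 2 < 1 := by norm_num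
  set S' : ℝ → ℝ := fun x => (sinTransform 1 x - 2 * sinTransform 2 x) / x with hS'
  have h1 : ∀ x, 0 < x → HasDerivAt (sinTransform 1) (S' x) x := fun x hx =>
    (hasDerivAt_sinTransform_of_pos hs hx).congr_deriv (by simp only [hS']; norm_num)
  have h2 : ∀ x, 0 < x → HasDerivAt S' (sinTransform 1 x - 1 / x) x := fun x hx => by
    have h3 := hasDerivAt_sinTransform_add_one hs x
    rw [one_add_one_eq_two] at h3
    refine (((h1 x hx).sub (h3.const_mul 2)).div (hasDerivAt_id x) hx.ne').congr_deriv ?_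
    simp only [Pi.sub_apply, id, hS']
    field_simp
    ring
  have hp : ∀ x : ℝ, 0 < x → HasDerivAt scaledExpInt (-scaledExpInt x + 1 / x) x :=
    fun x hx => hasDerivAt_scaledExpInt hx.ne'
  have hr : ∀ x : ℝ, 0 < x → HasDerivAt (fun x => scaledExpInt (-x))
      (scaledExpInt (-x) + 1 / x) x := fun x hx => by
    refine (hasDerivAt_comp_neg_of_hasDerivAt
      (hasDerivAt_scaledExpInt (neg_ne_zero.2 hx.ne'))).congr_deriv ?_
    rw [div_neg]
    ring
  have hD := eq_zero_of_second_deriv_eq_self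
    (D := fun x => sinTransform 1 x - (scaledExpInt x - scaledExpInt (-x)) / 2)
    (D' := fun x => S' x + (scaledExpInt x + scaledExpInt (-x)) / 2)
    (B := cosTransform 1 0 + 2)
    (fun x hx => ((h1 x hx).sub (((hp x hx).sub (hr x hx)).div_const 2)).congr_deriv (by ring))
    (fun x hx => ((h2 x hx).add (((hp x hx).add (hr x hx)).div_const 2)).congr_deriv (by ring))
    ?_ (fun x hx => ?_) hx
  · rw [oddSum_zero]
    linarith
  · have h3 := (continuous_sinTransform hs).tendsto 0 |>.mono_left (nhdsWithin_le_nhds (s := Ioi 0))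
    simpa [sinTransform_zero] using h3.sub (tendsto_scaledExpInt_sub.div_const 2)
  · refine (abs_sub _ _).trans (add_le_add (abs_sinTransform_le hs x) ?_)
    rw [abs_div, abs_two]
    linarith [abs_scaledExpInt_sub_le hx]

lemma sinTransform_natCast_add_one (m : ℕ) {x : ℝ} (hx : 0 < x) :
    sinTransform (m + 1) x = oddSum m x := by
  induction m generalizing x with
  | zero => simpa using sinTransform_one hx
  | succ m ih =>
    have hs : (1 : ℝ) / 2 < m + 1 := by
      have : (0 : ℝ) ≤ m := m.cast_nonneg
      linarith
    push_cast
    set D : ℝ → ℝ := fun y => sinTransform (m + 1 + 1) y - oddSum (m + 1) y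
    have hd : ∀ y, 0 < y → HasDerivAt D 0 y := fun y hy =>
      ((hasDerivAt_sinTransform_add_one hs y).sub (hasDerivAt_oddSum_succ m hy)).congr_deriv (by
        rw [ih hy, sub_self])
    have hlim : Tendsto D (𝓝[>] 0) (𝓝 0) := by
      have h3 := (continuous_sinTransform (s := m + 1 + 1) (by linarith)).tendsto 0 |>.mono_left
        (nhdsWithin_le_nhds (s := Ioi 0))
      simpa [sinTransform_zero] using h3.sub (tendsto_oddSum (m + 1))
    have hev : ∀ᶠ y in 𝓝[>] (0 : ℝ), D x = D y :=
      eventually_mem_nhdsWithin.mono fun y hy => eq_of_hasDerivAt_zero_Ioi hd hx hy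
    have : D x = 0 := tendsto_nhds_unique
      (tendsto_const_nhds.congr' (hev.mono fun y hy => hy)) hlim
    exact sub_eq_zero.1 this

/-! ### The terms A and B as transforms. -/

/-- The factor between the terms `A`, `B` and the half-line Fourier transforms. -/
def termConst (β ν : ℝ) : ℝ := 2 * β * Gamma ((ν + 1) / 2) / (√π * Gamma (ν / 2))

lemma cosTransform_neg (s x : ℝ) : cosTransform s (-x) = cosTransform s x := by
  simp [cosTransform]

lemma sinTransform_neg (s x : ℝ) : sinTransform s (-x) = -sinTransform s x := by
  simp [sinTransform, integral_neg]

lemma termA_eq {β a ν : ℝ} (ha : 0 < a) (hν : 0 < ν) (t : ℝ) :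
    termA β a ν t = termConst β ν * cosTransform ((ν + 1) / 2) (2 * a * √ν * t) := by
  have hG : 0 < Gamma (ν / 2) := Gamma_pos_of_pos (by positivity)
  have hπ : 0 < √π := sqrt_pos.2 pi_pos
  have h := gamma_mul_cosTransform (s := (ν + 1) / 2) (by linarith) (2 * a * √ν * t)
  rw [show (ν + 1) / 2 - 1 / 2 = ν / 2 by ring] at h
  have h' : termConst β ν * cosTransform ((ν + 1) / 2) (2 * a * √ν * t) =
      β * gammaBessel (ν / 2) ((2 * a * √ν * t) ^ 2 / 4) / Gamma (ν / 2) := by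
    rw [termConst, div_mul_eq_mul_div, mul_assoc, h]
    field_simp
  rw [h', termA]
  split_ifs with ht
  · rw [ht, mul_zero, zero_pow two_ne_zero, zero_div, gammaBessel_zero (by positivity)]
    field_simp
  · have hx : 0 < 2 * a * √ν * |t| := by
      have := abs_pos.2 ht
      positivity
    have hsq : (2 * a * √ν * t) ^ 2 = (2 * a * √ν * |t|) ^ 2 := by
      rw [mul_pow, mul_pow _ |t|, sq_abs]
    rw [hsq, gammaBessel_eq_besselK _ hx, show 2 * a * √ν * |t| / 2 = a * √ν * |t| by ring]
    ring

lemma termB_eq_of_pos {β a ν t : ℝ} (ha : 0 < a) (hν : 0 < ν) (ht : 0 < t) :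
    termB β a ν t = termConst β ν * sinTransform ((ν + 1) / 2) (2 * a * √ν * t) := by
  have hx : 0 < 2 * a * √ν * t := by positivity
  have hG : 0 < Gamma (ν / 2) := Gamma_pos_of_pos (by positivity)
  have hπ : 0 < √π := sqrt_pos.2 pi_pos
  rw [termB]
  split_ifs with h
  · have hm := h.choose_spec
    generalize h.choose = m at hm ⊢
    subst hm
    have h2 := sinTransform_natCast_add_one m hx
    rw [show ((m : ℝ) + 1) = (2 * m + 1 + 1) / 2 by ring] at h2
    rw [termBOdd, abs_of_pos ht, sign_of_pos ht, h2, termConst]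
    field_simp
  · have h2 := gamma_mul_sinTransform_eq_bessel_struve hν (fun m hm => h ⟨m, hm⟩) hx
    rw [termBGeneral, abs_of_pos ht, sign_of_pos ht, termConst]
    rw [show 2 * a * √ν * t / 2 = a * √ν * t by ring] at h2
    have h3 : 2 * β * Gamma ((ν + 1) / 2) / (√π * Gamma (ν / 2)) *
        sinTransform ((ν + 1) / 2) (2 * a * √ν * t) = 2 * β / (√π * Gamma (ν / 2)) *
        (Gamma ((ν + 1) / 2) * sinTransform ((ν + 1) / 2) (2 * a * √ν * t)) := by ring
    rw [h3, h2]
    field_simp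

lemma termB_neg (β a ν t : ℝ) : termB β a ν (-t) = -termB β a ν t := by
  rw [termB, termB]
  split_ifs with h
  · simp only [termBOdd, abs_neg, Real.sign_neg]
    ring
  · simp only [termBGeneral, abs_neg, Real.sign_neg]
    ring

lemma termB_eq {β a ν : ℝ} (ha : 0 < a) (hν : 0 < ν) (t : ℝ) :
    termB β a ν t = termConst β ν * sinTransform ((ν + 1) / 2) (2 * a * √ν * t) := by
  rcases lt_trichotomy t 0 with ht | rfl | ht
  · have h := termB_eq_of_pos (β := β) ha hν (neg_pos.2 ht)
    rw [termB_neg, mul_neg, sinTransform_neg] at h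
    linarith
  -- Oddness gives the value at 0 without evaluating the special functions there.
  · have h := termB_neg β a ν 0
    rw [neg_zero] at h
    rw [mul_zero, sinTransform_zero, mul_zero]
    linarith
  · exact termB_eq_of_pos ha hν ht

lemma continuous_termA {β a ν : ℝ} (ha : 0 < a) (hν : 0 < ν) : Continuous (termA β a ν) := by
  rw [funext (termA_eq ha hν)]
  exact continuous_const.mul
    ((continuous_cosTransform (by linarith)).comp (continuous_const_mul _))

lemma continuous_termB {β a ν : ℝ} (ha : 0 < a) (hν : 0 < ν) : Continuous (termB β a ν) := by
  rw [funext (termB_eq ha hν)]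
  exact continuous_const.mul
    ((continuous_sinTransform (by linarith)).comp (continuous_const_mul _))

/-! ### The density and its Fourier transform. -/

/-- One branch of the density, as a function of `|x|`. -/
def halfDensity (β a ν y : ℝ) : ℝ :=
  β / a * tConst ν * (1 + 1 / ν * (y / (2 * a)) ^ 2) ^ (-(ν + 1) / 2)

lemma halfDensity_mul {β a ν : ℝ} (ha : 0 < a) (hν : 0 < ν) (u : ℝ) :
    2 * a * √ν * halfDensity β a ν (2 * a * √ν * u) =
      termConst β ν * (1 + u ^ 2) ^ (-((ν + 1) / 2)) := by
  have hG : 0 < Gamma (ν / 2) := Gamma_pos_of_pos (by positivity)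
  have hs : 0 < √ν := sqrt_pos.2 hν
  have hπ : 0 < √π := sqrt_pos.2 pi_pos
  have h1 : 1 / ν * (2 * a * √ν * u / (2 * a)) ^ 2 = u ^ 2 := by
    rw [show 2 * a * √ν * u / (2 * a) = √ν * u by field_simp, mul_pow, sq_sqrt hν.le]
    field_simp
  rw [halfDensity, h1, tConst, termConst, neg_div, sqrt_mul pi_pos.le]
  field_simp

lemma integrable_halfDensity {β a ν : ℝ} (ha : 0 < a) (hν : 0 < ν) :
    Integrable (halfDensity β a ν) := by
  have hc : 2 * a * √ν ≠ 0 := by positivity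
  rw [← integrable_comp_mul_left_iff _ hc]
  refine ((integrable_one_add_sq_rpow (s := (ν + 1) / 2) (by linarith)).const_mul
    (termConst β ν / (2 * a * √ν))).congr (ae_of_all _ fun u => ?_)
  have h := halfDensity_mul (β := β) ha hν u
  simp only
  rw [div_mul_eq_mul_div, ← h, mul_div_cancel_left₀ _ hc]

lemma integral_mul_halfDensity {β a ν : ℝ} (ha : 0 < a) (hν : 0 < ν) (φ : ℝ → ℝ) :
    ∫ y in Ioi (0 : ℝ), φ y * halfDensity β a ν y = termConst β ν *
      ∫ u in Ioi (0 : ℝ), φ (2 * a * √ν * u) * (1 + u ^ 2) ^ (-((ν + 1) / 2)) := by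
  have hc : 0 < 2 * a * √ν := by positivity
  have h := integral_comp_mul_left_Ioi (fun y => φ y * halfDensity β a ν y) 0 hc
  rw [mul_zero, smul_eq_mul, inv_mul_eq_div, eq_div_iff hc.ne'] at h
  rw [← h, ← integral_mul_const, ← integral_const_mul]
  refine integral_congr_ae (ae_of_all _ fun u => ?_)
  linear_combination (φ (2 * a * √ν * u)) * halfDensity_mul (β := β) ha hν u

lemma integrable_cexp_mul_halfDensity {β a ν : ℝ} (ha : 0 < a) (hν : 0 < ν) (t : ℝ) :
    Integrable fun y : ℝ => Complex.exp (Complex.I * t * y) * (halfDensity β a ν y : ℂ) := by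
  refine (integrable_halfDensity ha hν).ofReal.bdd_mul (by fun_prop) (c := 1)
    (ae_of_all _ fun y => ?_)
  rw [Complex.norm_exp]
  simp

/-- The Fourier transform of one branch of the density. -/
lemma integral_cexp_mul_halfDensity {β a ν : ℝ} (ha : 0 < a) (hν : 0 < ν) (t : ℝ) :
    ∫ y in Ioi (0 : ℝ), Complex.exp (Complex.I * t * y) * (halfDensity β a ν y : ℂ) =
      (termA β a ν t : ℂ) + Complex.I * (termB β a ν t : ℂ) := by
  have hi := (integrable_halfDensity (β := β) ha hν).integrableOn (s := Ioi 0)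
  have hcos : IntegrableOn (fun y => cos (t * y) * halfDensity β a ν y) (Ioi 0) :=
    hi.bdd_mul (by fun_prop) (c := 1) (ae_of_all _ fun y => abs_cos_le_one _)
  have hsin : IntegrableOn (fun y => sin (t * y) * halfDensity β a ν y) (Ioi 0) :=
    hi.bdd_mul (by fun_prop) (c := 1) (ae_of_all _ fun y => abs_sin_le_one _)
  have hA : termA β a ν t = ∫ y in Ioi (0 : ℝ), cos (t * y) * halfDensity β a ν y := by
    rw [termA_eq ha hν, integral_mul_halfDensity ha hν, cosTransform]
    simp only [mul_left_comm t, mul_comm t, mul_assoc]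
  have hB : termB β a ν t = ∫ y in Ioi (0 : ℝ), sin (t * y) * halfDensity β a ν y := by
    rw [termB_eq ha hν, integral_mul_halfDensity ha hν, sinTransform]
    simp only [mul_left_comm t, mul_comm t, mul_assoc]
  rw [hA, hB, ← integral_complex_ofReal, ← integral_complex_ofReal, ← integral_const_mul,
    ← integral_add hcos.ofReal (hsin.ofReal.const_mul _)]
  refine integral_congr_ae (ae_of_all _ fun y => ?_)
  have : Complex.I * t * y = ((t * y : ℝ) : ℂ) * Complex.I := by push_cast; ring
  simp only [this, Complex.exp_mul_I, ← Complex.ofReal_cos, ← Complex.ofReal_sin]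
  push_cast
  ring

lemma tConst_pos {ν : ℝ} (hν : 0 < ν) : 0 < tConst ν := by
  have h1 : 0 < Gamma ((ν + 1) / 2) := Gamma_pos_of_pos (by positivity)
  have h2 : 0 < Gamma (ν / 2) := Gamma_pos_of_pos (by positivity)
  have h3 : 0 < √(π * ν) := sqrt_pos.2 (mul_pos pi_pos hν)
  rw [tConst]
  positivity

lemma alphaStar_mem_Ioo {α ν₁ ν₂ : ℝ} (h0 : 0 < α) (h1 : α < 1) (hν₁ : 0 < ν₁) (hν₂ : 0 < ν₂) :
    alphaStar α ν₁ ν₂ ∈ Ioo (0 : ℝ) 1 := by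
  have e1 : 0 < α * tConst ν₁ := mul_pos h0 (tConst_pos hν₁)
  have e2 : 0 < (1 - α) * tConst ν₂ := mul_pos (by linarith) (tConst_pos hν₂)
  rw [alphaStar]
  exact ⟨by positivity, (div_lt_one (by positivity)).2 (by linarith)⟩

lemma measurable_pdfAST (α ν₁ ν₂ : ℝ) : Measurable (pdfAST α ν₁ ν₂) :=
  Measurable.ite measurableSet_Iic (by fun_prop) (by fun_prop)

lemma halfDensity_nonneg {β a ν : ℝ} (hβ : 0 < β) (ha : 0 < a) (hν : 0 < ν) (y : ℝ) :
    0 ≤ halfDensity β a ν y := by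
  have := tConst_pos hν
  rw [halfDensity]
  positivity

lemma pdfAST_of_nonpos {α ν₁ ν₂ x : ℝ} (hx : x ≤ 0) :
    pdfAST α ν₁ ν₂ x = halfDensity α (alphaStar α ν₁ ν₂) ν₁ (-x) := by
  rw [pdfAST, if_pos hx, halfDensity, neg_div _ x, neg_sq]

lemma pdfAST_of_pos {α ν₁ ν₂ x : ℝ} (hx : 0 < x) :
    pdfAST α ν₁ ν₂ x = halfDensity (1 - α) (1 - alphaStar α ν₁ ν₂) ν₂ x := by
  rw [pdfAST, if_neg hx.not_ge, halfDensity]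

/-- The Fourier transform of the density of the asymmetric Student's t-distribution. -/
lemma integral_cexp_mul_pdfAST {α ν₁ ν₂ : ℝ} (h0 : 0 < α) (h1 : α < 1) (hν₁ : 0 < ν₁)
    (hν₂ : 0 < ν₂) (t : ℝ) :
    ∫ x : ℝ, Complex.exp (Complex.I * t * x) * (pdfAST α ν₁ ν₂ x : ℂ) =
      (termA α (alphaStar α ν₁ ν₂) ν₁ t : ℂ) + (termA (1 - α) (1 - alphaStar α ν₁ ν₂) ν₂ t : ℂ) +
      Complex.I * ((termB (1 - α) (1 - alphaStar α ν₁ ν₂) ν₂ t : ℂ) -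
        (termB α (alphaStar α ν₁ ν₂) ν₁ t : ℂ)) := by
  obtain ⟨ha0, ha1⟩ := alphaStar_mem_Ioo h0 h1 hν₁ hν₂
  set a := alphaStar α ν₁ ν₂ with ha
  have hb : 0 < 1 - a := by linarith
  -- The left half is a branch evaluated at -x; reflecting it reverses the sign of t, which keeps A
  -- and negates B.
  have hL : EqOn (fun x : ℝ => Complex.exp (Complex.I * t * x) * (pdfAST α ν₁ ν₂ x : ℂ))
      (fun x : ℝ => (fun y : ℝ => Complex.exp (Complex.I * (-t : ℝ) * y) *
        (halfDensity α a ν₁ y : ℂ)) (-x)) (Iic 0) := fun x hx => by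
    simp only [pdfAST_of_nonpos (mem_Iic.1 hx), ← ha]
    push_cast
    ring_nf
  have hR : EqOn (fun x : ℝ => Complex.exp (Complex.I * t * x) * (pdfAST α ν₁ ν₂ x : ℂ))
      (fun x : ℝ => Complex.exp (Complex.I * t * x) * (halfDensity (1 - α) (1 - a) ν₂ x : ℂ))
      (Ioi 0) := fun x hx => by
    simp only [pdfAST_of_pos (mem_Ioi.1 hx), ← ha]
  have iL : IntegrableOn (fun x : ℝ => Complex.exp (Complex.I * t * x) *
      (pdfAST α ν₁ ν₂ x : ℂ)) (Iic 0) :=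
    ((integrable_cexp_mul_halfDensity ha0 hν₁ (-t)).comp_neg).integrableOn.congr_fun hL.symm
      measurableSet_Iic
  have iR : IntegrableOn (fun x : ℝ => Complex.exp (Complex.I * t * x) *
      (pdfAST α ν₁ ν₂ x : ℂ)) (Ioi 0) :=
    (integrable_cexp_mul_halfDensity hb hν₂ t).integrableOn.congr_fun hR.symm measurableSet_Ioi
  rw [← intervalIntegral.integral_Iic_add_Ioi iL iR, setIntegral_congr_fun measurableSet_Iic hL,
    setIntegral_congr_fun measurableSet_Ioi hR, integral_comp_neg_Iic 0 (fun y : ℝ =>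
      Complex.exp (Complex.I * (-t : ℝ) * y) * (halfDensity α a ν₁ y : ℂ)), neg_zero,
    integral_cexp_mul_halfDensity ha0 hν₁, integral_cexp_mul_halfDensity hb hν₂,
    termB_neg, termA_eq ha0 hν₁, termA_eq ha0 hν₁, mul_neg, cosTransform_neg]
  push_cast
  ring

lemma pdfAST_nonneg {α ν₁ ν₂ : ℝ} (h0 : 0 < α) (h1 : α < 1) (hν₁ : 0 < ν₁)
    (hν₂ : 0 < ν₂) (x : ℝ) : 0 ≤ pdfAST α ν₁ ν₂ x := by
  obtain ⟨ha0, ha1⟩ := alphaStar_mem_Ioo h0 h1 hν₁ hν₂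
  rcases le_or_gt x 0 with hx | hx
  · rw [pdfAST_of_nonpos hx]
    exact halfDensity_nonneg h0 ha0 hν₁ _
  · rw [pdfAST_of_pos hx]
    exact halfDensity_nonneg (by linarith) (by linarith) hν₂ _

end AST

end

theorem theorem1 {Ω : Type*} [MeasurableSpace Ω] (P : MeasureTheory.Measure Ω)
    [MeasureTheory.IsProbabilityMeasure P] (X : Ω → ℝ) (hX : AEMeasurable X P)
    (α ν₁ ν₂ : ℝ) (hα0 : 0 < α) (hα1 : α < 1) (hν₁ : 0 < ν₁) (hν₂ : 0 < ν₂)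
    (hpdf : P.map X = MeasureTheory.volume.withDensity
      (fun x : ℝ => ENNReal.ofReal (AST.pdfAST α ν₁ ν₂ x))) :
    (∀ t : ℝ,
      ∫ ω, Complex.exp (Complex.I * (t : ℂ) * (X ω : ℂ)) ∂P =
        ((AST.termA α (AST.alphaStar α ν₁ ν₂) ν₁ t : ℝ) : ℂ) +
        ((AST.termA (1 - α) (1 - AST.alphaStar α ν₁ ν₂) ν₂ t : ℝ) : ℂ) +
        Complex.I *
          (((AST.termB (1 - α) (1 - AST.alphaStar α ν₁ ν₂) ν₂ t : ℝ) : ℂ) -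
            ((AST.termB α (AST.alphaStar α ν₁ ν₂) ν₁ t : ℝ) : ℂ))) ∧
    ContinuousAt (AST.termA α (AST.alphaStar α ν₁ ν₂) ν₁) 0 ∧
    ContinuousAt (AST.termA (1 - α) (1 - AST.alphaStar α ν₁ ν₂) ν₂) 0 ∧
    ContinuousAt (AST.termB α (AST.alphaStar α ν₁ ν₂) ν₁) 0 ∧
    ContinuousAt (AST.termB (1 - α) (1 - AST.alphaStar α ν₁ ν₂) ν₂) 0 := by
  obtain ⟨ha0, ha1⟩ := AST.alphaStar_mem_Ioo hα0 hα1 hν₁ hν₂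
  have hb : 0 < 1 - AST.alphaStar α ν₁ ν₂ := by linarith
  refine ⟨fun t => ?_, (AST.continuous_termA ha0 hν₁).continuousAt,
    (AST.continuous_termA hb hν₂).continuousAt, (AST.continuous_termB ha0 hν₁).continuousAt,
    (AST.continuous_termB hb hν₂).continuousAt⟩
  have hmeas := AST.measurable_pdfAST α ν₁ ν₂
  rw [← AST.integral_cexp_mul_pdfAST hα0 hα1 hν₁ hν₂ t,
    ← MeasureTheory.integral_map hX (f := fun x : ℝ => Complex.exp (Complex.I * t * x))
      (Continuous.aestronglyMeasurable (by fun_prop)), hpdf,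
    integral_withDensity_eq_integral_toReal_smul (by fun_prop)
      (Filter.Eventually.of_forall fun x => ENNReal.ofReal_lt_top)]
  refine MeasureTheory.integral_congr_ae (Filter.Eventually.of_forall fun x => ?_)
  simp only
  rw [ENNReal.toReal_ofReal (AST.pdfAST_nonneg hα0 hα1 hν₁ hν₂ x), Complex.real_smul, mul_comm]
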